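/- **Setting.** Let $p\ge 1$, and consider $$\min_{x_1,\dots,x_p,y}\ \sum_{i=1}^p f_i(x_i)+h(y)\quad\text{s.t.}\quad \mathbf A\mathbf x+By+b=0,\qquad \mathbf A\mathbf x=\sum_{i=1}^pA_ix_i, \tag{P}$$ where $x_i\in\mathbb R^{n_i}$, $y\in\mathbb R^q$, $A_i\in\mathbb R^{m\times n_i}$, $0\neq B\in\mathbb R^{m\times q}$, $b\in\mathbb R^m$, the functions $f_i:\mathbb R^{n_i}\to\mathbb R\cup\{+\infty\}$ are proper and $h:\mathbb R^q\to\mathbb R$. Let $Q_i\in\mathbb R^{n_i\times n_i}$ and $P\in\mathbb R^{q\times q}$ be symmetric positive semidefinite, $\alpha>0$, $\beta\in(0,2)$, $\|x\|_M^2=x^TMx$, and $$\mathcal L^\alpha(\mathbf x,y,z)=\sum_i f_i(x_i)+h(y)+\langle z,\mathbf A\mathbf x+By+b\rangle+\tfrac{\alpha}{2}\|\mathbf A\mathbf x+By+b\|^2 .$$ A sequence $(\mathbf x^k,y^k,z^k)_{k\ge0}$ is generated by PADMM if for all $k\ge 0$ $$x_i^{k+1}\in\arg\min_{x_i}\ \mathcal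 L^\alpha(x_{<i}^{k+1},x_i,x_{>i}^k,y^k,z^k)+\tfrac12\|x_i-x_i^k\|_{Q_i}^2\quad(i=1,\dots,p),$$ $$y^{k+1}\in\arg\min_{y}\ \mathcal L^\alpha(\mathbf x^{k+1},y,z^k)+\tfrac12\|y-y^k\|_{P}^2,\qquad z^{k+1}=z^k+\alpha\beta(\mathbf A\mathbf x^{k+1}+By^{k+1}+b);$$ in each subproblem the summands $f_j(x_j)$, $h(y)$ that do not depend on the minimization variable are left out. Let $\partial$ be the limiting (Mordukhovich) subdifferential and $\Delta u^k=u^k-u^{k-1}$. **Assumptions.** (A1) Each $f_i$ is lower semicontinuous and $f_i(x_i)\to+\infty$ as $\|x_i\|\to\infty$. (A2) $h$ is bounded below and differentiable, and $\nabla h$ is Lipschitz with constant $L_h\ge 0$. (A3) $\operatorname{Im}\mathbf A\subseteq\operatorname{Im}B$ and $b\in\operatorname{Im}B$. (A4) For each $i$, $Q_i\succeq q_iI$ with a constant $q_i\ge0$; and for each $i$ either (i) $q_i>0$, or (ii) there is given $\epsilon_i>0$ with $f_i(v)-f_i(\tilde v)-\langle s,v-\tilde v\rangle\ge-\frac{\epsilon_i}{2}\|v-\tilde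 v\|^2$ for all $v,\tilde v$ and all $s\in\partial f_i(\tilde v)$. **Constants.** Let $\epsilon_0>1$, let $\lambda_{++}$ be the smallest strictly positive eigenvalue of $B^TB$, $\rho=1-|1-\beta|$, and $$c_1=\frac1{\alpha\rho\lambda_{++}},\quad c_2=\frac{2\beta}{\alpha\rho^2\lambda_{++}},\quad c_3=c_2\|P\|^2,\quad c_4=c_2(\|P\|+L_h)^2,\quad c_5=\beta^{-1}|1-\beta|c_1,$$ $$\bar D=2P+\alpha B^TB-L_hI-2\epsilon_0(c_3+c_4)I,\qquad \bar\tau=\min_{i}\max\{q_i,\lambda_{\min}(\alpha A_i^TA_i-\epsilon_iI)\},$$ $$\sigma=\min\Big\{\lambda_{\min}(\bar D),\ \bar\tau,\ \frac{\epsilon_0-1}{\alpha\beta}\Big\},$$ where the second entry of the maximum is of relevance only for those $i$ with $q_i=0$. Let $$\bar{\mathcal L}(\mathbf x,y,z,y',z')=\mathcal L^\alpha(\mathbf x,y,z)+\epsilon_0c_5\|B^T(z-z')\|^2+\epsilon_0c_3\|y-y'\|^2 .$$ **Theorem.** Suppose that (A1)–(A4) hold and $\sigma>0$. Let $(\mathbf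 x^k,y^k,z^k)_{k\ge0}$ be a bounded sequence generated by PADMM, and let $\Omega$ be the set of limit points of $(\mathbf x^k,y^k,z^k,y^{k-1},z^{k-1})_{k\ge1}$. Suppose that $\bar{\mathcal L}$ has the Kurdyka–Łojasiewicz property on $\Omega$: for every $v^*\in\Omega$ there are $\epsilon>0$, $\eta>0$ and a continuous concave $\psi:[0,\eta]\to[0,\infty)$ with $\psi(0)=0$ that is $C^1$ on $(0,\eta)$ with $\psi'>0$ there, such that $$\psi'(\bar{\mathcal L}(v)-\bar{\mathcal L}(v^*))\cdot\operatorname{dist}(0,\partial\bar{\mathcal L}(v))\ge1$$ for all $v$ with $\operatorname{dist}(v,\Omega)<\epsilon$ and $\bar{\mathcal L}(v^*)<\bar{\mathcal L}(v)<\bar{\mathcal L}(v^*)+\eta$ (where $\operatorname{dist}(0,\emptyset)=+\infty$). Then, with $u^k=(\mathbf x^k,y^k,z^k)$, $$\sum_{k=1}^\infty\|\Delta u^k\|\ \le\ \sum_{k=1}^\infty\Big(\sum_{i=1}^p\|\Delta x_i^k\|+\|\Delta y^k\|+\|\Delta z^k\|\Big)<+\infty .$$ Consequently $(u^k)$ is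 a Cauchy sequence, and it converges to some $(\mathbf x^*,y^*,z^*)$ that is a stationary point of (P) with its multiplier: $0\in\partial f_i(x_i^*)+A_i^Tz^*$ for $i=1,\dots,p$, $\nabla h(y^*)+B^Tz^*=0$, and $\mathbf A\mathbf x^*+By^*+b=0$. -/

import Mathlib

open Filter Topology

noncomputable section

/-! ### Variational analysis -/

/-- The Fréchet subdifferential of an extended-real-valued function. The `liminf` of the difference
quotients is `≥ 0` exactly when, for every `ε > 0`, the quotients are `≥ -ε` near the point. It is
empty outside the effective domain. -/
def frechetSubdiff {E : Type*} [NormedAddCommGroup E] [InnerProductSpace ℝ E]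
    (Φ : E → EReal) (x : E) : Set E :=
  {s | Φ x ≠ ⊤ ∧ ∀ ε : ℝ, 0 < ε → ∀ᶠ y in 𝓝 x,
    Φ x + ((inner ℝ s (y - x) - ε * ‖y - x‖ : ℝ) : EReal) ≤ Φ y}

/-- The limiting (Mordukhovich) subdifferential. -/
def limitingSubdiff {E : Type*} [NormedAddCommGroup E] [InnerProductSpace ℝ E]
    (Φ : E → EReal) (x : E) : Set E :=
  {s | Φ x ≠ ⊤ ∧ ∃ (xs ss : ℕ → E), Tendsto xs atTop (𝓝 x) ∧
    Tendsto (fun k => Φ (xs k)) atTop (𝓝 (Φ x)) ∧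
    (∀ k, ss k ∈ frechetSubdiff Φ (xs k)) ∧ Tendsto ss atTop (𝓝 s)}

/-- The class of desingularizing functions on `[0, η]`. -/
structure IsDesingularizing (η : ℝ) (ψ : ℝ → ℝ) : Prop where
  continuousOn : ContinuousOn ψ (Set.Icc 0 η)
  concaveOn : ConcaveOn ℝ (Set.Icc 0 η) ψ
  nonneg : ∀ s ∈ Set.Icc 0 η, 0 ≤ ψ s
  map_zero : ψ 0 = 0
  contDiffOn : ContDiffOn ℝ 1 ψ (Set.Ioo 0 η)
  deriv_pos : ∀ s ∈ Set.Ioo 0 η, 0 < deriv ψ s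

/-- The Kurdyka–Łojasiewicz property of `Φ` on a set `Ω`. Distances take values in `[0, ∞]`, and
the distance to the empty set is `∞`. -/
def HasKLOn {E : Type*} [NormedAddCommGroup E] [InnerProductSpace ℝ E]
    (Φ : E → EReal) (Ω : Set E) : Prop :=
  ∀ v₀ ∈ Ω, ∃ ε : ℝ, 0 < ε ∧ ∃ η : ℝ, 0 < η ∧ ∃ ψ : ℝ → ℝ, IsDesingularizing η ψ ∧
    ∀ v : E, Metric.infEDist v Ω < ENNReal.ofReal ε →
      Φ v₀ < Φ v → Φ v < Φ v₀ + (η : EReal) →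
      1 ≤ ENNReal.ofReal (deriv ψ (Φ v - Φ v₀).toReal) *
        Metric.infEDist 0 (limitingSubdiff Φ v)

/-- The set of limits of subsequences of a sequence. -/
def subseqLimits {E : Type*} [TopologicalSpace E] (v : ℕ → E) : Set E :=
  {w | ∃ φ : ℕ → ℕ, StrictMono φ ∧ Tendsto (fun j => v (φ j)) atTop (𝓝 w)}

/-! ### Eigenvalues -/

/-- The smallest eigenvalue `λ_min` (of a symmetric operator). -/
def minEigenvalue {E : Type*} [NormedAddCommGroup E] [InnerProductSpace ℝ E]
    (T : E →L[ℝ] E) : ℝ :=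
  sInf {μ : ℝ | Module.End.HasEigenvalue (T : E →ₗ[ℝ] E) μ}

/-- The smallest strictly positive eigenvalue `λ₊₊` (of a symmetric operator that has one). -/
def minPosEigenvalue {E : Type*} [NormedAddCommGroup E] [InnerProductSpace ℝ E]
    (T : E →L[ℝ] E) : ℝ :=
  sInf {μ : ℝ | 0 < μ ∧ Module.End.HasEigenvalue (T : E →ₗ[ℝ] E) μ}

/-! ### The problem and the algorithm -/

/-- `ℝ^d` with its Euclidean norm. -/
abbrev Vec (d : ℕ) : Type := EuclideanSpace ℝ (Fin d)

/-- Block vectors `(x_1, …, x_p)` with the Euclidean norm of the Cartesian product. -/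
abbrev Blocks {p : ℕ} (n : Fin p → ℕ) : Type := PiLp 2 (fun i => Vec (n i))

/-- Triples `(x, y, z)` with the Euclidean norm of the Cartesian product. -/
abbrev Triple {p : ℕ} (n : Fin p → ℕ) (q m : ℕ) : Type :=
  WithLp 2 (Blocks n × WithLp 2 (Vec q × Vec m))

/-- Quintuples `((x, y, z), (y', z'))` with the Euclidean norm of the Cartesian product. -/
abbrev Quintuple {p : ℕ} (n : Fin p → ℕ) (q m : ℕ) : Type :=
  WithLp 2 (Triple n q m × WithLp 2 (Vec q × Vec m))

/-- The triple `(x, y, z)`. -/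
def triple {p : ℕ} {n : Fin p → ℕ} {q m : ℕ} (x : Blocks n) (y : Vec q) (z : Vec m) :
    Triple n q m :=
  WithLp.toLp 2 (x, WithLp.toLp 2 (y, z))

/-- The quintuple `(x, y, z, y', z')`. -/
def quintuple {p : ℕ} {n : Fin p → ℕ} {q m : ℕ} (x : Blocks n) (y : Vec q) (z : Vec m)
    (y' : Vec q) (z' : Vec m) : Quintuple n q m :=
  WithLp.toLp 2 (triple x y z, WithLp.toLp 2 (y', z'))

/-- The data of `min ∑ f_i(x_i) + h(y)` subject to `∑ A_i x_i + B y + b = 0`, together with the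
proximal matrices `Q_i`, `P`, the penalty `α` and the dual step size `β` of the method. Matrices
are given as linear maps between Euclidean spaces, so that `‖·‖` is the spectral norm and the
adjoint is the transpose. -/
structure PADMM {p : ℕ} (n : Fin p → ℕ) (q m : ℕ) where
  /-- the nonsmooth block functions -/
  f : (i : Fin p) → Vec (n i) → EReal
  /-- the smooth function -/
  h : Vec q → ℝ
  /-- the coefficient matrices of the blocks -/
  A : (i : Fin p) → Vec (n i) →L[ℝ] Vec m
  /-- the coefficient matrix of `y` -/
  B : Vec q →L[ℝ] Vec m
  /-- the constant term of the constraint -/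
  b : Vec m
  /-- the proximal matrices of the blocks -/
  Q : (i : Fin p) → Vec (n i) →L[ℝ] Vec (n i)
  /-- the proximal matrix of `y` -/
  P : Vec q →L[ℝ] Vec q
  /-- the penalty parameter -/
  α : ℝ
  /-- the dual step size -/
  β : ℝ

namespace PADMM

variable {p : ℕ} {n : Fin p → ℕ} {q m : ℕ} (S : PADMM n q m)

/-- `A x = ∑ A_i x_i`. -/
def Amul (x : Blocks n) : Vec m := ∑ i, S.A i (x i)

/-- The constraint residual `A x + B y + b`. -/
def residual (x : Blocks n) (y : Vec q) : Vec m := S.Amul x + S.B y + S.b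

/-- The coupling term `⟨z, A x + B y + b⟩ + (α/2) ‖A x + B y + b‖²` of the augmented
Lagrangian. -/
def coupling (x : Blocks n) (y : Vec q) (z : Vec m) : ℝ :=
  inner ℝ z (S.residual x y) + S.α / 2 * ‖S.residual x y‖ ^ 2

/-- The augmented Lagrangian. -/
def augLagrangian (x : Blocks n) (y : Vec q) (z : Vec m) : EReal :=
  (∑ i, S.f i (x i)) + ((S.h y + S.coupling x y z : ℝ) : EReal)

/-- The block vector `(x⁺_{<i}, v, x_{>i})`. -/
def mixed (xnew x : Blocks n) (i : Fin p) (v : Vec (n i)) : Blocks n :=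
  WithLp.toLp 2 (Function.update (fun j => if j < i then xnew j else x j) i v)

/-- The objective of the `x_i`-subproblem as a function of `v = x_i`: the augmented Lagrangian plus
the proximal term, without the summands `f_j` (`j ≠ i`) and `h`, which do not depend on `v`. (So
the `argmin` is the intended one also when such a summand is `+∞` at the starting point.) -/
def blockObjective (xnew x : Blocks n) (y : Vec q) (z : Vec m) (i : Fin p) (v : Vec (n i)) :
    EReal :=
  S.f i v + ((S.coupling (mixed xnew x i v) y z
    + 1 / 2 * inner ℝ (v - x i) (S.Q i (v - x i)) : ℝ) : EReal)

/-- The objective of the `y`-subproblem as a function of `w = y`: the augmented Lagrangian plus the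
proximal term, without the summands `f_j`, which do not depend on `w`. -/
def yObjective (xnew : Blocks n) (y : Vec q) (z : Vec m) (w : Vec q) : ℝ :=
  S.h w + S.coupling xnew w z + 1 / 2 * inner ℝ (w - y) (S.P (w - y))

/-- `(x^k, y^k, z^k)` is a sequence generated by the proximal ADMM. -/
structure IsSequence (x : ℕ → Blocks n) (y : ℕ → Vec q) (z : ℕ → Vec m) : Prop where
  x_step : ∀ k i, IsMinOn (S.blockObjective (x (k + 1)) (x k) (y k) (z k) i) Set.univ (x (k + 1) i)
  y_step : ∀ k, IsMinOn (S.yObjective (x (k + 1)) (y k) (z k)) Set.univ (y (k + 1))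
  z_step : ∀ k, z (k + 1) = z k + (S.α * S.β) • S.residual (x (k + 1)) (y (k + 1))

/-- The setting: each `f_i` is proper (with values in `ℝ ∪ {+∞}`), the proximal matrices are
symmetric positive semidefinite, `α > 0` and `0 < β < 2`. Moreover `B ≠ 0`, so that `Bᵀ B` has a
strictly positive eigenvalue. -/
structure Setting : Prop where
  f_ne_bot : ∀ i v, S.f i v ≠ ⊥
  f_proper : ∀ i, ∃ v, S.f i v ≠ ⊤
  Q_pos : ∀ i, (S.Q i).IsPositive
  P_pos : S.P.IsPositive
  α_pos : 0 < S.α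
  β_pos : 0 < S.β
  β_lt : S.β < 2
  B_ne : S.B ≠ 0

/-- Each `f_i` is lower semicontinuous and coercive. -/
def A1 : Prop :=
  ∀ i, LowerSemicontinuous (S.f i) ∧ Tendsto (S.f i) (Bornology.cobounded (Vec (n i))) (𝓝 ⊤)

/-- `h` is bounded below and differentiable with an `L`-Lipschitz gradient. -/
def A2 (L : NNReal) : Prop :=
  BddBelow (Set.range S.h) ∧ Differentiable ℝ S.h ∧ LipschitzWith L (gradient S.h)

/-- `Im A ⊆ Im B` and `b ∈ Im B`. -/
def A3 : Prop :=
  Set.range S.Amul ⊆ Set.range S.B ∧ S.b ∈ Set.range S.B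

/-- `g` satisfies `g(v) - g(w) - ⟨s, v - w⟩ ≥ -(ε/2) ‖v - w‖²` for all `v`, `w` and all
`s ∈ ∂g(w)`. -/
def WeaklyConvex {d : ℕ} (g : Vec d → EReal) (ε : ℝ) : Prop :=
  ∀ v w s, s ∈ limitingSubdiff g w →
    g w + ((inner ℝ s (v - w) - ε / 2 * ‖v - w‖ ^ 2 : ℝ) : EReal) ≤ g v

/-- The numbers `qc i ≥ 0` satisfy `Q_i ⪰ qc i • I` (where `qc i = 0` is always possible), and for
every `i` one has `qc i > 0`, or `f_i` is weakly convex with the constant `εc i > 0`. -/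
def A4 (qc εc : Fin p → ℝ) : Prop :=
  ∀ i, (0 ≤ qc i ∧ ∀ v, qc i * ‖v‖ ^ 2 ≤ inner ℝ v (S.Q i v)) ∧
    (0 < qc i ∨ (0 < εc i ∧ WeaklyConvex (S.f i) (εc i)))

/-! ### The constants -/

/-- `Bᵀ B`. -/
def BtB : Vec q →L[ℝ] Vec q := S.B.adjoint ∘L S.B

/-- `ρ(β) = 1 - |1 - β|`. -/
def rho : ℝ := 1 - |1 - S.β|

def c₁ : ℝ := 1 / (S.α * S.rho * minPosEigenvalue S.BtB)

def c₂ : ℝ := 2 * S.β / (S.α * S.rho ^ 2 * minPosEigenvalue S.BtB)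

def c₃ : ℝ := S.c₂ * ‖S.P‖ ^ 2

def c₄ (L : ℝ) : ℝ := S.c₂ * (‖S.P‖ + L) ^ 2

def c₅ : ℝ := S.β⁻¹ * |1 - S.β| * S.c₁

/-- `D = 2 P + α Bᵀ B - L I`. -/
def D (L : ℝ) : Vec q →L[ℝ] Vec q :=
  (2 : ℝ) • S.P + S.α • S.BtB - L • ContinuousLinearMap.id ℝ (Vec q)

/-- `D̄ = D - 2 ε₀ (c₃ + c₄) I`. -/
def Dbar (L ε₀ : ℝ) : Vec q →L[ℝ] Vec q :=
  S.D L - (2 * ε₀ * (S.c₃ + S.c₄ L)) • ContinuousLinearMap.id ℝ (Vec q)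

/-- `τ̄ = min_i max {q_i, λ_min(α A_iᵀ A_i - ε_i I)}`. -/
def tauBar (qc εc : Fin p → ℝ) : ℝ :=
  ⨅ i, max (qc i) (minEigenvalue
    (S.α • ((S.A i).adjoint ∘L S.A i) - εc i • ContinuousLinearMap.id ℝ (Vec (n i))))

/-- `σ = min {λ_min(D̄), τ̄, (ε₀ - 1) / (α β)}`. -/
def sigma (L ε₀ : ℝ) (qc εc : Fin p → ℝ) : ℝ :=
  min (min (minEigenvalue (S.Dbar L ε₀)) (S.tauBar qc εc)) ((ε₀ - 1) / (S.α * S.β))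

/-! ### The modified augmented Lagrangian, its limit set, and stationarity -/

/-- The modified augmented Lagrangian
`L(x, y, z) + ε₀ c₅ ‖Bᵀ (z - z')‖² + ε₀ c₃ ‖y - y'‖²` at `((x, y, z), (y', z'))`. -/
def modLagrangian (ε₀ : ℝ) (v : Quintuple n q m) : EReal :=
  S.augLagrangian v.fst.fst v.fst.snd.fst v.fst.snd.snd
    + ((ε₀ * S.c₅ * ‖S.B.adjoint (v.fst.snd.snd - v.snd.snd)‖ ^ 2
      + ε₀ * S.c₃ * ‖v.fst.snd.fst - v.snd.fst‖ ^ 2 : ℝ) : EReal)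

/-- The set of limit points of `(x^k, y^k, z^k, y^{k-1}, z^{k-1})`, `k ≥ 1`. -/
def limitSet (x : ℕ → Blocks n) (y : ℕ → Vec q) (z : ℕ → Vec m) : Set (Quintuple n q m) :=
  subseqLimits (fun k => quintuple (x (k + 1)) (y (k + 1)) (z (k + 1)) (y k) (z k))

/-- `(x, y)` is a stationary point of the problem with Lagrange multiplier `z`:
`0 ∈ ∂f_i(x_i) + A_iᵀ z`, `∇h(y) + Bᵀ z = 0` and `A x + B y + b = 0`. -/
structure IsStationary (x : Blocks n) (y : Vec q) (z : Vec m) : Prop where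
  x_cond : ∀ i, ∃ s ∈ limitingSubdiff (S.f i) (x i), s + (S.A i).adjoint z = 0
  y_cond : gradient S.h y + S.B.adjoint z = 0
  feasible : S.residual x y = 0

end PADMM

end

section Generic

/-! The argument is the descent scheme for Kurdyka–Łojasiewicz functions, run on the modified
augmented Lagrangian: its values decrease by a multiple of the squared step, it has subgradients
bounded by the step, and its values converge along convergent subsequences.

Decrease. The block and `y` updates lower the augmented Lagrangian by multiples of the squared steps
(`exists_block_decrease`, `y_decrease`), while the dual update raises it by `‖Δz‖² / (αβ)`.
Optimality in `y` makes `Bᵀ Δz` satisfy a recursion with factor `1 - β`, where `|1 - β| < 1`, driven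
by differences of `y`. Since `Δz` lies in the range of `B`, the eigenvalue `λ₊₊` turns this into a
bound on `‖Δz‖²` (`dual_bound`). Taking this bound `ε₀ > 1` times pays for the ascent and leaves a
decrease in `z` too. The terms of the bound that refer to the previous step are absorbed by the two
terms added to the Lagrangian, and the remaining cost in `y` is covered by the positivity of `D̄`
(`exists_lyapunov_decrease`).

Subgradients. Minimality in a block subproblem gives `f i` a global quadratic minorant touching at
the new iterate. Adding these to a quadratic minorant of the smooth part yields a Fréchet
subgradient of the whole function without any sum rule (`modSubgradient_mem`), and the optimality
conditions reduce its components to differences of iterates (`exists_subgradient_bound`). The same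
minorants have bounded slopes, so with lower semicontinuity they give convergence of the values of
`f i` (`tendsto_f_of_tendsto`).

Finite length. The decreasing values converge to the value at any limit point. The KL inequality
holds near all of `Ω`, and a bounded sequence approaches `Ω`, so the inequality attached to a single
limit point suffices; concavity of `ψ` then makes the steps summable
(`summable_of_desingularizing`). Stationarity follows by passing to the limit in the optimality
conditions. -/

theorem EReal.coe_sum_real {ι : Type*} (s : Finset ι) (g : ι → ℝ) :
    ((∑ i ∈ s, g i : ℝ) : EReal) = ∑ i ∈ s, (g i : EReal) := by
  classical
  induction s using Finset.induction_on with
  | empty => simp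
  | insert a s ha ih => rw [Finset.sum_insert ha, Finset.sum_insert ha, EReal.coe_add, ih]

variable {E : Type*} [NormedAddCommGroup E] [InnerProductSpace ℝ E]

/-! ### Spectral bounds -/

theorem LinearMap.IsSymmetric.inner_apply_eq_sum_eigenvalues [FiniteDimensional ℝ E]
    {T : E →ₗ[ℝ] E} (hT : T.IsSymmetric) (v : E) :
    inner ℝ v (T v) =
      ∑ i, hT.eigenvalues rfl i * inner ℝ (hT.eigenvectorBasis rfl i) v ^ 2 := by
  rw [← (hT.eigenvectorBasis rfl).sum_inner_mul_inner]
  refine Finset.sum_congr rfl fun i _ => ?_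
  rw [← hT (hT.eigenvectorBasis rfl i) v, hT.apply_eigenvectorBasis, real_inner_smul_left,
    real_inner_comm v]
  simp only [RCLike.ofReal_real_eq_id, id_eq]
  ring

theorem LinearMap.IsSymmetric.norm_sq_apply_eq_sum_eigenvalues [FiniteDimensional ℝ E]
    {T : E →ₗ[ℝ] E} (hT : T.IsSymmetric) (v : E) :
    ‖T v‖ ^ 2 =
      ∑ i, hT.eigenvalues rfl i ^ 2 * inner ℝ (hT.eigenvectorBasis rfl i) v ^ 2 := by
  rw [← (hT.eigenvectorBasis rfl).sum_sq_norm_inner_right]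
  refine Finset.sum_congr rfl fun i _ => ?_
  rw [← hT (hT.eigenvectorBasis rfl i) v, hT.apply_eigenvectorBasis, real_inner_smul_left,
    Real.norm_eq_abs, sq_abs]
  simp only [RCLike.ofReal_real_eq_id, id_eq]
  ring

theorem minEigenvalue_mul_norm_sq_le [FiniteDimensional ℝ E] {T : E →L[ℝ] E}
    (hT : (T : E →ₗ[ℝ] E).IsSymmetric) (v : E) :
    minEigenvalue T * ‖v‖ ^ 2 ≤ inner ℝ v (T v) := by
  have h := hT.inner_apply_eq_sum_eigenvalues v
  rw [ContinuousLinearMap.coe_coe] at h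
  rw [h, ← (hT.eigenvectorBasis rfl).sum_sq_norm_inner_right v, Finset.mul_sum]
  refine Finset.sum_le_sum fun i _ => ?_
  rw [Real.norm_eq_abs, sq_abs]
  refine mul_le_mul_of_nonneg_right ?_ (sq_nonneg _)
  -- In dimension zero the infimum is over the empty set, but then the sum has no terms and this is
  -- never reached.
  exact csInf_le (Module.End.finite_hasEigenvalue _).bddBelow (hT.hasEigenvalue_eigenvalues rfl i)

variable {F : Type*} [NormedAddCommGroup F] [InnerProductSpace ℝ F]

theorem isSymmetric_adjoint_comp_self [CompleteSpace E] [CompleteSpace F] (B : E →L[ℝ] F) :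
    ((B.adjoint ∘L B : E →L[ℝ] E) : E →ₗ[ℝ] E).IsSymmetric := by
  intro u v
  simp [ContinuousLinearMap.adjoint_inner_left, ContinuousLinearMap.adjoint_inner_right]

theorem inner_adjoint_comp_self [CompleteSpace E] [CompleteSpace F] (B : E →L[ℝ] F) (v : E) :
    inner ℝ v ((B.adjoint ∘L B : E →L[ℝ] E) v) = ‖B v‖ ^ 2 := by
  rw [ContinuousLinearMap.comp_apply, ContinuousLinearMap.adjoint_inner_right,
    real_inner_self_eq_norm_sq]

theorem nonneg_of_hasEigenvalue_adjoint_comp_self [CompleteSpace E] [CompleteSpace F]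
    (B : E →L[ℝ] F) {μ : ℝ}
    (hμ : Module.End.HasEigenvalue ((B.adjoint ∘L B : E →L[ℝ] E) : E →ₗ[ℝ] E) μ) : 0 ≤ μ := by
  obtain ⟨v, hv⟩ := hμ.exists_hasEigenvector
  have h1 := inner_adjoint_comp_self B v
  have h2 : (B.adjoint ∘L B : E →L[ℝ] E) v = μ • v := hv.apply_eq_smul
  rw [h2, real_inner_smul_right, real_inner_self_eq_norm_sq] at h1
  have h3 : 0 < ‖v‖ ^ 2 := by have := norm_pos_iff.2 hv.2; positivity
  nlinarith [sq_nonneg ‖B v‖]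

theorem minPosEigenvalue_adjoint_comp_self_pos [FiniteDimensional ℝ E] [CompleteSpace F]
    {B : E →L[ℝ] F} (hB : B ≠ 0) :
    haveI := FiniteDimensional.complete ℝ E
    0 < minPosEigenvalue (B.adjoint ∘L B) := by
  have := FiniteDimensional.complete ℝ E
  set T := (B.adjoint ∘L B : E →L[ℝ] E)
  have hT := isSymmetric_adjoint_comp_self B
  have hfin : {μ : ℝ | 0 < μ ∧ Module.End.HasEigenvalue (T : E →ₗ[ℝ] E) μ}.Finite :=
    (Module.End.finite_hasEigenvalue (T : E →ₗ[ℝ] E)).subset fun μ h => h.2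
  have hne : {μ : ℝ | 0 < μ ∧ Module.End.HasEigenvalue (T : E →ₗ[ℝ] E) μ}.Nonempty := by
    by_contra hemp
    apply hB
    ext v
    have h := hT.inner_apply_eq_sum_eigenvalues v
    rw [ContinuousLinearMap.coe_coe, inner_adjoint_comp_self, Finset.sum_eq_zero] at h
    · simpa using h
    · intro i _
      have h1 := hT.hasEigenvalue_eigenvalues rfl i
      have h2 := nonneg_of_hasEigenvalue_adjoint_comp_self B h1
      rcases h2.lt_or_eq with h3 | h3
      · exact (hemp ⟨_, h3, h1⟩).elim
      · have h4 : hT.eigenvalues rfl i = 0 := h3.symm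
        rw [h4, zero_mul]
  exact (hne.csInf_mem hfin).1

/-- For `w = B u`, both sides expand in an eigenbasis of `Bᵀ B`: `‖w‖²` has weights `μ` and `‖Bᵀ
w‖²` has weights `μ²`. Every eigenvalue satisfies `λ₊₊ μ ≤ μ²`, trivially when `μ = 0`; this is why
`w` must lie in the range of `B`. -/
theorem minPosEigenvalue_mul_norm_sq_le [FiniteDimensional ℝ E] [CompleteSpace F]
    (B : E →L[ℝ] F) {w : F} (hw : w ∈ Set.range B) :
    haveI := FiniteDimensional.complete ℝ E
    minPosEigenvalue (B.adjoint ∘L B) * ‖w‖ ^ 2 ≤ ‖B.adjoint w‖ ^ 2 := by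
  have := FiniteDimensional.complete ℝ E
  obtain ⟨u, rfl⟩ := hw
  have hT := isSymmetric_adjoint_comp_self B
  have h1 := hT.inner_apply_eq_sum_eigenvalues u
  have h2 := hT.norm_sq_apply_eq_sum_eigenvalues u
  rw [ContinuousLinearMap.coe_coe] at h1 h2
  rw [inner_adjoint_comp_self] at h1
  rw [ContinuousLinearMap.comp_apply] at h2
  rw [h1, h2, Finset.mul_sum]
  refine Finset.sum_le_sum fun i _ => ?_
  rw [← mul_assoc]
  refine mul_le_mul_of_nonneg_right ?_ (sq_nonneg _)
  have h3 := hT.hasEigenvalue_eigenvalues rfl i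
  have h4 := nonneg_of_hasEigenvalue_adjoint_comp_self B h3
  rw [sq]
  rcases h4.lt_or_eq with h5 | h5
  · exact mul_le_mul_of_nonneg_right (csInf_le ⟨0, fun μ hμ => hμ.1.le⟩ ⟨h5, h3⟩) h4
  · have h6 : hT.eigenvalues rfl i = 0 := h5.symm
    rw [h6, mul_zero, mul_zero]

/-! ### Functions with a Lipschitz gradient -/

theorem neg_le_sub_sub_inner_of_lipschitzWith_gradient [CompleteSpace E] {h : E → ℝ} {L : NNReal}
    (hd : Differentiable ℝ h) (hL : LipschitzWith L (gradient h)) (u v : E) :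
    -(L / 2 * ‖v - u‖ ^ 2) ≤ h v - h u - inner ℝ (gradient h u) (v - u) := by
  set d := v - u with hd'
  -- The added term `L / 2 * t ^ 2 * ‖d‖ ^ 2` compensates the Lipschitz variation of the gradient
  -- along the segment, so `φ` is monotone; comparing `φ 0` with `φ 1` is the claim.
  set φ : ℝ → ℝ := fun t => h (u + t • d) - t * inner ℝ (gradient h u) d + L / 2 * t ^ 2 * ‖d‖ ^ 2
  have hder : ∀ t, HasDerivAt φ
      (inner ℝ (gradient h (u + t • d)) d - inner ℝ (gradient h u) d + L * t * ‖d‖ ^ 2) t := by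
    intro t
    have h1 : HasDerivAt (fun t : ℝ => u + t • d) d t := by
      simpa using ((hasDerivAt_id t).smul_const d).const_add u
    have h2 := (hd (u + t • d)).hasGradientAt.hasFDerivAt.comp_hasDerivAt t h1
    have h3 : HasDerivAt (fun t : ℝ => t * inner ℝ (gradient h u) d) (inner ℝ (gradient h u) d) t := by
      simpa using (hasDerivAt_id t).mul_const (inner ℝ (gradient h u) d)
    have h4 : HasDerivAt (fun t : ℝ => L / 2 * t ^ 2 * ‖d‖ ^ 2) (L * t * ‖d‖ ^ 2) t := by
      have := ((hasDerivAt_pow 2 t).const_mul (L / 2 : ℝ)).mul_const (‖d‖ ^ 2)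
      refine this.congr_deriv ?_
      rw [show (2 - 1 : ℕ) = 1 from rfl, pow_one]
      push_cast
      ring
    exact (h2.sub h3).add h4
  have hmono : MonotoneOn φ (Set.Icc 0 1) := by
    refine monotoneOn_of_deriv_nonneg (convex_Icc 0 1)
      (fun t _ => (hder t).continuousAt.continuousWithinAt)
      (fun t _ => (hder t).differentiableAt.differentiableWithinAt) fun t ht => ?_
    rw [interior_Icc] at ht
    rw [(hder t).deriv, ← inner_sub_left]
    have h1 := hL.dist_le_mul (u + t • d) u
    rw [dist_eq_norm, dist_eq_norm, add_sub_cancel_left, norm_smul, Real.norm_eq_abs,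
      abs_of_pos ht.1] at h1
    have h2 := abs_real_inner_le_norm (gradient h (u + t • d) - gradient h u) d
    have h3 := neg_le_of_abs_le h2
    nlinarith [norm_nonneg d]
  have := hmono (Set.left_mem_Icc.2 zero_le_one) (Set.right_mem_Icc.2 zero_le_one) zero_le_one
  have hv : u + d = v := by rw [hd', add_sub_cancel]
  simp only [φ, zero_smul, add_zero, one_smul, hv] at this
  linarith

theorem abs_sub_sub_inner_le_of_lipschitzWith_gradient [CompleteSpace E] {h : E → ℝ} {L : NNReal}
    (hd : Differentiable ℝ h) (hL : LipschitzWith L (gradient h)) (u v : E) :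
    |h v - h u - inner ℝ (gradient h u) (v - u)| ≤ L / 2 * ‖v - u‖ ^ 2 := by
  have hg : gradient (fun w => -h w) = fun w => -gradient h w := by
    ext1 w
    simp [gradient, fderiv_fun_neg]
  have h1 := neg_le_sub_sub_inner_of_lipschitzWith_gradient hd hL u v
  have h2 := neg_le_sub_sub_inner_of_lipschitzWith_gradient hd.neg
    (L := L) (by rw [show gradient (-h) = fun w => -gradient h w from hg]; exact hL.neg) u v
  rw [show gradient (-h) = fun w => -gradient h w from hg] at h2
  simp only [Pi.neg_apply, inner_neg_left] at h2
  rw [abs_le]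
  constructor <;> linarith

/-- A linear term dominates a quadratic one near the origin, so testing with a short step along `-G`
contradicts `G ≠ 0`. This turns minimality up to a quadratic error into a first-order condition. -/
theorem eq_zero_of_forall_nonneg_inner_add {G : E} {C : ℝ}
    (h : ∀ d, 0 ≤ inner ℝ G d + C * ‖d‖ ^ 2) : G = 0 := by
  by_contra hG
  have hG' : 0 < ‖G‖ ^ 2 := by have := norm_pos_iff.2 hG; positivity
  set t : ℝ := 1 / (2 * (|C| + 1))
  have ht : 0 < t := by positivity
  have htC : t * |C| < 1 := by
    have : t * (2 * (|C| + 1)) = 1 := by simp only [t]; field_simp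
    nlinarith [abs_nonneg C]
  have h1 := h (-(t • G))
  rw [inner_neg_right, real_inner_smul_right, real_inner_self_eq_norm_sq, norm_neg, norm_smul,
    Real.norm_eq_abs, abs_of_pos ht] at h1
  have h2 : 0 ≤ t * ‖G‖ ^ 2 * (t * C - 1) := by linarith
  have h3 : t * C ≤ t * |C| := mul_le_mul_of_nonneg_left (le_abs_self C) ht.le
  nlinarith [mul_pos ht hG']

/-! ### Subgradients -/

/-- A quadratic minorant that touches at `x` gives a Fréchet subgradient. -/
theorem mem_frechetSubdiff_of_quadratic_minorant {Φ : E → EReal} {x s : E} (hx : Φ x ≠ ⊤) (C : ℝ)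
    (h : ∀ v, Φ x + ((inner ℝ s (v - x) - C * ‖v - x‖ ^ 2 : ℝ) : EReal) ≤ Φ v) :
    s ∈ frechetSubdiff Φ x := by
  refine ⟨hx, fun ε hε => ?_⟩
  have h1 : ∀ᶠ v in 𝓝 x, |C| * ‖v - x‖ < ε := by
    have : Tendsto (fun v : E => |C| * ‖v - x‖) (𝓝 x) (𝓝 (|C| * ‖x - x‖)) :=
      (Continuous.tendsto (by fun_prop) x)
    rw [sub_self, norm_zero, mul_zero] at this
    exact this.eventually_lt_const hε
  filter_upwards [h1] with v hv
  refine le_trans ?_ (h v)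
  refine add_le_add_right (EReal.coe_le_coe_iff.2 ?_) _
  nlinarith [norm_nonneg (v - x), mul_le_mul_of_nonneg_right (le_abs_self C) (norm_nonneg (v - x))]

theorem frechetSubdiff_subset_limitingSubdiff (Φ : E → EReal) (x : E) :
    frechetSubdiff Φ x ⊆ limitingSubdiff Φ x := fun s hs =>
  ⟨hs.1, fun _ => x, fun _ => s, tendsto_const_nhds, tendsto_const_nhds, fun _ => hs,
    tendsto_const_nhds⟩

theorem add_coe_le_of_isMinOn {X : Type*} {f : X → EReal} {g : X → ℝ} {x : X}
    (h : IsMinOn (fun v => f v + (g v : EReal)) Set.univ x) (v : X) :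
    f x + ((g x - g v : ℝ) : EReal) ≤ f v := by
  have h1 : f x + (g x : EReal) ≤ f v + (g v : EReal) := h (Set.mem_univ v)
  have h2 := add_le_add_left h1 ((-g v : ℝ) : EReal)
  rw [add_assoc, add_assoc, ← EReal.coe_add, ← EReal.coe_add, add_neg_cancel, EReal.coe_zero,
    add_zero] at h2
  exact h2

/-! ### Summability from the Kurdyka–Łojasiewicz inequality -/

/-- Concavity converts the decrease of `φ` into a decrease of `ψ ∘ φ`, and the KL inequality bounds
the slope from below by `1 / (C δ k)`. With the quadratic decrease this gives `δ (k + 1) ^ 2 ≤ δ k *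
(C / a) * Δ`, which AM–GM makes linear and telescoping. -/
theorem summable_of_desingularizing {η : ℝ} {ψ : ℝ → ℝ} (hη : 0 < η) (hψ : IsDesingularizing η ψ)
    {φ δ : ℕ → ℝ} {a C : ℝ} (ha : 0 < a) (hC : 0 ≤ C)
    (hφ0 : ∀ k, 0 ≤ φ k) (hφ : Tendsto φ atTop (𝓝 0)) (hδ : ∀ k, 0 ≤ δ k)
    (hdec : ∀ k, a * δ (k + 1) ^ 2 ≤ φ k - φ (k + 1))
    (hKL : ∀ᶠ k in atTop, 0 < φ k → φ k < η → 1 ≤ deriv ψ (φ k) * (C * δ k)) :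
    Summable δ := by
  obtain ⟨N, hN⟩ := eventually_atTop.1 (hKL.and (hφ.eventually_lt_const hη))
  have hstep : ∀ k, N ≤ k →
      2 * δ (k + 1) ≤ δ k + C / a * (ψ (φ k) - ψ (φ (k + 1))) := by
    intro k hk
    have hlt := (hN k hk).2
    have hd := hdec k
    have hle : φ (k + 1) ≤ φ k := by nlinarith [sq_nonneg (δ (k + 1))]
    rcases hle.lt_or_eq with hlt' | heq
    · have hpos : 0 < φ k := (hφ0 _).trans_lt hlt'
      have h1 := (hN k hk).1 hpos hlt
      have hmem : φ k ∈ Set.Ioo 0 η := ⟨hpos, hlt⟩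
      have hder : HasDerivAt ψ (deriv ψ (φ k)) (φ k) :=
        ((hψ.contDiffOn.differentiableOn one_ne_zero).differentiableAt
          (isOpen_Ioo.mem_nhds hmem)).hasDerivAt
      -- By concavity the tangent slope at the right endpoint is at most the secant slope. The left
      -- endpoint may be `0`, where differentiability is not available.
      have h2 := hψ.concaveOn.le_slope_of_hasDerivAt (x := φ (k + 1)) (y := φ k)
        ⟨hφ0 _, hlt'.le.trans hlt.le⟩ ⟨hpos.le, hlt.le⟩ hlt' hder
      rw [slope_def_field, le_div_iff₀ (sub_pos.2 hlt')] at h2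
      set Δ := ψ (φ k) - ψ (φ (k + 1))
      have h3 : a * δ (k + 1) ^ 2 ≤ C * δ k * Δ := by
        have h4 : 0 ≤ C * δ k := mul_nonneg hC (hδ k)
        have h5 : 0 ≤ φ k - φ (k + 1) := by linarith
        calc a * δ (k + 1) ^ 2 ≤ 1 * (φ k - φ (k + 1)) := by linarith
          _ ≤ (deriv ψ (φ k) * (C * δ k)) * (φ k - φ (k + 1)) := by gcongr
          _ = C * δ k * (deriv ψ (φ k) * (φ k - φ (k + 1))) := by ring
          _ ≤ C * δ k * Δ := by gcongr
      have h6 : δ (k + 1) ^ 2 ≤ δ k * (C / a * Δ) := by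
        rw [show δ k * (C / a * Δ) = (C * δ k * Δ) / a by ring, le_div_iff₀ ha]
        linarith
      have hΔ : 0 ≤ C / a * Δ := by
        have : 0 ≤ Δ := le_trans (mul_nonneg (hψ.deriv_pos _ hmem).le (by linarith)) h2
        positivity
      have h7 : (2 * δ (k + 1)) ^ 2 ≤ (δ k + C / a * Δ) ^ 2 := by
        nlinarith [sq_nonneg (δ k - C / a * Δ)]
      exact (sq_le_sq₀ (by have := hδ (k + 1); positivity) (add_nonneg (hδ k) hΔ)).1 h7
    -- Without strict decrease the next step vanishes, so the KL inequality, which is void when `φ k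
    -- = 0`, is not needed.
    · have h0 : δ (k + 1) = 0 := by
        have : δ (k + 1) ^ 2 ≤ 0 := by rw [heq, sub_self] at hd; nlinarith
        exact pow_eq_zero_iff two_ne_zero |>.1 (le_antisymm this (sq_nonneg _))
      rw [heq, h0]
      simpa using hδ k
  -- The terms `2 * δ (l + N)` and `C / a * ψ (φ (l + N))` are what telescoping leaves over; both
  -- are nonnegative and are dropped afterwards.
  have hsum : ∀ l, ∑ k ∈ Finset.range l, δ (k + N) + 2 * δ (l + N) + C / a * ψ (φ (l + N)) ≤
      2 * δ N + C / a * ψ (φ N) := by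
    intro l
    induction l with
    | zero => simp
    | succ l ih =>
      have := hstep (l + N) (Nat.le_add_left _ _)
      rw [Finset.sum_range_succ, show l + 1 + N = l + N + 1 by ring]
      linarith
  rw [← summable_nat_add_iff N]
  refine summable_of_sum_range_le (c := 2 * δ N + C / a * ψ (φ N)) (fun k => hδ _) fun l => ?_
  have h1 := hsum l
  have h2 : 0 ≤ C / a * ψ (φ (l + N)) :=
    mul_nonneg (div_nonneg hC ha.le)
      (hψ.nonneg _ ⟨hφ0 _, (hN _ (Nat.le_add_left _ _)).2.le⟩)
  linarith [hδ (l + N)]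

/-- A bounded sequence in a proper space approaches its set of limit points. -/
theorem tendsto_infEDist_subseqLimits {X : Type*} [PseudoMetricSpace X] [ProperSpace X] {v : ℕ → X}
    (hv : Bornology.IsBounded (Set.range v)) {ε : ENNReal} (hε : 0 < ε) :
    ∀ᶠ k in atTop, Metric.infEDist (v k) (subseqLimits v) < ε := by
  by_contra hcon
  rw [not_eventually] at hcon
  obtain ⟨φ, hφ, hfar⟩ := extraction_of_frequently_atTop hcon
  obtain ⟨w, -, θ, hθ, hw⟩ := tendsto_subseq_of_bounded hv (x := v ∘ φ) fun k => ⟨φ k, rfl⟩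
  have hmem : w ∈ subseqLimits v := ⟨φ ∘ θ, hφ.comp hθ, hw⟩
  have h1 : Tendsto (fun j => edist ((v ∘ φ ∘ θ) j) w) atTop (𝓝 0) :=
    tendsto_iff_edist_tendsto_0.1 hw
  obtain ⟨j, hj⟩ := (h1.eventually_lt_const hε).exists
  exact hfar (θ j) ((Metric.infEDist_le_edist_of_mem hmem).trans_lt hj)

/-! ### Norms in products -/

theorem WithLp.norm_toLp_prod_le {E F : Type*} [SeminormedAddCommGroup E]
    [SeminormedAddCommGroup F] (a : E) (b : F) : ‖WithLp.toLp 2 (a, b)‖ ≤ ‖a‖ + ‖b‖ := by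
  rw [WithLp.prod_norm_eq_of_L2]
  refine Real.sqrt_le_iff.2 ⟨by positivity, ?_⟩
  simp only [WithLp.toLp_fst, WithLp.toLp_snd]
  nlinarith [norm_nonneg a, norm_nonneg b]

theorem PiLp.norm_le_sum_norm {ι : Type*} [Fintype ι] {β : ι → Type*}
    [∀ i, SeminormedAddCommGroup (β i)] (x : PiLp 2 β) : ‖x‖ ≤ ∑ i, ‖x i‖ := by
  rw [PiLp.norm_eq_of_L2]
  refine Real.sqrt_le_iff.2 ⟨by positivity, ?_⟩
  exact Finset.sum_sq_le_sq_sum_of_nonneg fun i _ => norm_nonneg _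

end Generic
-- Elementary identities and bounds for quadratic forms
section Expansion

variable {E : Type*} [NormedAddCommGroup E] [InnerProductSpace ℝ E]

theorem inner_quadratic_add {Q : E →L[ℝ] E} (hQ : (Q : E →ₗ[ℝ] E).IsSymmetric) (a d : E) :
    inner ℝ (a + d) (Q (a + d)) = inner ℝ a (Q a) + 2 * inner ℝ (Q a) d + inner ℝ d (Q d) := by
  have h1 : inner ℝ (Q a) d = inner ℝ a (Q d) := hQ a d
  rw [map_add, inner_add_left, inner_add_right, inner_add_right, ← h1, real_inner_comm (Q a) d]
  ring

theorem inner_quadratic_le (Q : E →L[ℝ] E) (d : E) : inner ℝ d (Q d) ≤ ‖Q‖ * ‖d‖ ^ 2 := by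
  calc inner ℝ d (Q d) ≤ ‖d‖ * ‖Q d‖ := real_inner_le_norm _ _
    _ ≤ ‖d‖ * (‖Q‖ * ‖d‖) := by gcongr; exact Q.le_opNorm d
    _ = ‖Q‖ * ‖d‖ ^ 2 := by ring

theorem norm_sq_apply_le {F : Type*} [NormedAddCommGroup F] [InnerProductSpace ℝ F]
    (A : E →L[ℝ] F) (d : E) : ‖A d‖ ^ 2 ≤ ‖A‖ ^ 2 * ‖d‖ ^ 2 := by
  rw [← mul_pow]
  gcongr
  exact A.le_opNorm d

end Expansion

/-! ### Expansion of the residual and the coupling term -/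

namespace PADMM

variable {p : ℕ} {n : Fin p → ℕ} {q m : ℕ} (S : PADMM n q m)

theorem Amul_sub (x x' : Blocks n) : S.Amul (x' - x) = S.Amul x' - S.Amul x := by
  simp [Amul, Finset.sum_sub_distrib]

theorem residual_sub (x x' : Blocks n) (y y' : Vec q) :
    S.residual x' y' - S.residual x y = S.Amul (x' - x) + S.B (y' - y) := by
  rw [Amul_sub, map_sub, residual, residual]
  abel

/-- The coupling is affine in `z` and quadratic in the residual, so this expansion is exact. It
serves the block, `y` and dual updates as well as the subgradient of the whole function. -/
theorem coupling_eq_add (x x' : Blocks n) (y y' : Vec q) (z z' : Vec m) (e : Vec m)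
    (he : S.residual x' y' - S.residual x y = e) :
    S.coupling x' y' z' = S.coupling x y z + inner ℝ (z + S.α • S.residual x y) e
      + inner ℝ (z' - z) (S.residual x y) + inner ℝ (z' - z) e + S.α / 2 * ‖e‖ ^ 2 := by
  have h : S.residual x' y' = S.residual x y + e := by rw [← he]; abel
  rw [coupling, coupling, h, norm_add_sq_real]
  simp only [inner_add_left, inner_add_right, inner_sub_left, real_inner_smul_left]
  ring

/-! ### The Gauss–Seidel sweep over the blocks -/

/-- The block vector whose first `j` blocks are taken from `xnew` and the others from `x`. -/
def sweep (xnew x : Blocks n) (j : ℕ) : Blocks n :=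
  WithLp.toLp 2 fun i => if i.val < j then xnew i else x i

theorem sweep_zero (xnew x : Blocks n) : sweep xnew x 0 = x := by
  ext i : 1
  simp [sweep]

theorem sweep_card (xnew x : Blocks n) : sweep xnew x p = xnew := by
  ext i : 1
  simp [sweep]

theorem mixed_old (xnew x : Blocks n) (i : Fin p) : mixed xnew x i (x i) = sweep xnew x i := by
  ext j : 1
  by_cases hj : j = i
  · subst hj
    simp [mixed, sweep]
  · simp [mixed, sweep, Function.update_of_ne hj]

/-- Together with `mixed_old`, this makes the block vectors before and after the `i`-th update
consecutive members of one family, so that the changes of the coupling telescope over the blocks. -/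
theorem mixed_new (xnew x : Blocks n) (i : Fin p) :
    mixed xnew x i (xnew i) = sweep xnew x (i + 1) := by
  ext j : 1
  by_cases hj : j = i
  · subst hj
    simp [mixed, sweep]
  · have h : j < i ↔ j.val < i.val + 1 := by
      have : j.val ≠ i.val := fun h => hj (Fin.ext h)
      rw [Fin.lt_def]
      omega
    simp [mixed, sweep, Function.update_of_ne hj, h]

theorem residual_mixed_sub (xnew x : Blocks n) (y : Vec q) (i : Fin p) (v w : Vec (n i)) :
    S.residual (mixed xnew x i v) y - S.residual (mixed xnew x i w) y = S.A i (v - w) := by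
  rw [residual_sub, sub_self, map_zero, add_zero, Amul, Finset.sum_eq_single i]
  · simp [mixed]
  · intro j _ hj
    simp [mixed, Function.update_of_ne hj]
  · simp

/-- The subgradient of `f i` supplied by the optimality condition of the `i`-th subproblem. -/
noncomputable def blockSubgradient (xnew x : Blocks n) (y : Vec q) (z : Vec m) (i : Fin p) : Vec (n i) :=
  -((S.A i).adjoint (z + S.α • S.residual (sweep xnew x (i + 1)) y)) - S.Q i (xnew i - x i)

variable {S}

theorem blockObjective_ne_top (hS : S.Setting) {xnew x : Blocks n} {y : Vec q} {z : Vec m}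
    {i : Fin p} (hmin : IsMinOn (S.blockObjective xnew x y z i) Set.univ (xnew i)) :
    S.f i (xnew i) ≠ ⊤ := by
  obtain ⟨v, hv⟩ := hS.f_proper i
  intro htop
  have h1 := add_coe_le_of_isMinOn hmin v
  rw [htop, EReal.top_add_coe, top_le_iff] at h1
  exact hv h1

/-- The remaining part of the objective is a quadratic polynomial in `v`, so minimality bounds `f i`
below by a quadratic. The minorant is global, which is what allows it to be summed over blocks and
evaluated at arbitrary points later. -/
theorem add_inner_blockSubgradient_le (hS : S.Setting) {xnew x : Blocks n} {y : Vec q} {z : Vec m}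
    {i : Fin p} (hmin : IsMinOn (S.blockObjective xnew x y z i) Set.univ (xnew i))
    (v : Vec (n i)) :
    S.f i (xnew i) + ((inner ℝ (S.blockSubgradient xnew x y z i) (v - xnew i)
      - (S.α / 2 * ‖S.A i‖ ^ 2 + ‖S.Q i‖ / 2) * ‖v - xnew i‖ ^ 2 : ℝ) : EReal) ≤ S.f i v := by
  refine le_trans (add_le_add_right (EReal.coe_le_coe_iff.2 ?_) _) (add_coe_le_of_isMinOn hmin v)
  have h1 := S.coupling_eq_add (mixed xnew x i (xnew i)) (mixed xnew x i v) y y z z _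
    (S.residual_mixed_sub xnew x y i v (xnew i))
  have h2 := inner_quadratic_add (hS.Q_pos i).isSymmetric (xnew i - x i) (v - xnew i)
  rw [show xnew i - x i + (v - xnew i) = v - x i by abel] at h2
  rw [h1, h2, blockSubgradient, mixed_new, sub_self, inner_zero_left, inner_zero_left,
    inner_sub_left, inner_neg_left, ContinuousLinearMap.adjoint_inner_left]
  have h3 := norm_sq_apply_le (S.A i) (v - xnew i)
  have h4 := inner_quadratic_le (S.Q i) (v - xnew i)
  have h5 := mul_le_mul_of_nonneg_left h3 (half_pos hS.α_pos).le
  linarith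

theorem blockSubgradient_mem (hS : S.Setting) {xnew x : Blocks n} {y : Vec q} {z : Vec m}
    {i : Fin p} (hmin : IsMinOn (S.blockObjective xnew x y z i) Set.univ (xnew i)) :
    S.blockSubgradient xnew x y z i ∈ frechetSubdiff (S.f i) (xnew i) :=
  mem_frechetSubdiff_of_quadratic_minorant (blockObjective_ne_top hS hmin) _
    (add_inner_blockSubgradient_le hS hmin)

theorem toReal_add_le_toReal {a b : EReal} {r : ℝ} (ha : a ≠ ⊥) (ha' : a ≠ ⊤) (hb : b ≠ ⊥)
    (hb' : b ≠ ⊤) (h : a + (r : EReal) ≤ b) : a.toReal + r ≤ b.toReal := by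
  rw [← EReal.coe_le_coe_iff, EReal.coe_add, EReal.coe_toReal ha' ha, EReal.coe_toReal hb' hb]
  exact h

theorem block_decrease_of_Q (hS : S.Setting) {i : Fin p} {c : ℝ}
    (hQ : ∀ v, c * ‖v‖ ^ 2 ≤ inner ℝ v (S.Q i v))
    {xnew x : Blocks n} {y : Vec q} {z : Vec m}
    (hmin : IsMinOn (S.blockObjective xnew x y z i) Set.univ (xnew i)) (hx : S.f i (x i) ≠ ⊤) :
    c / 2 * ‖xnew i - x i‖ ^ 2 ≤ (S.f i (x i)).toReal - (S.f i (xnew i)).toReal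
      + (S.coupling (sweep xnew x i) y z - S.coupling (sweep xnew x (i + 1)) y z) := by
  have h1 := toReal_add_le_toReal (hS.f_ne_bot _ _) (blockObjective_ne_top hS hmin)
    (hS.f_ne_bot _ _) hx (add_coe_le_of_isMinOn hmin (x i))
  rw [mixed_new, mixed_old, sub_self, inner_zero_left] at h1
  linarith [hQ (xnew i - x i)]

/-- Weak convexity is applied with the subgradient from the optimality condition. Its linear part
cancels that of the coupling, leaving `α / 2 * ‖A i Δ‖ ^ 2 - ε / 2 * ‖Δ‖ ^ 2` and a nonnegative
proximal term. -/
theorem block_decrease_of_weaklyConvex (hS : S.Setting) {i : Fin p} {c ε : ℝ}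
    (hf : WeaklyConvex (S.f i) ε) (hA : ∀ v, c * ‖v‖ ^ 2 ≤ S.α * ‖S.A i v‖ ^ 2 - ε * ‖v‖ ^ 2)
    {xnew x : Blocks n} {y : Vec q} {z : Vec m}
    (hmin : IsMinOn (S.blockObjective xnew x y z i) Set.univ (xnew i)) (hx : S.f i (x i) ≠ ⊤) :
    c / 2 * ‖xnew i - x i‖ ^ 2 ≤ (S.f i (x i)).toReal - (S.f i (xnew i)).toReal
      + (S.coupling (sweep xnew x i) y z - S.coupling (sweep xnew x (i + 1)) y z) := by
  have h1 := toReal_add_le_toReal (hS.f_ne_bot _ _) (blockObjective_ne_top hS hmin)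
    (hS.f_ne_bot _ _) hx (hf (x i) (xnew i) _
      (frechetSubdiff_subset_limitingSubdiff _ _ (blockSubgradient_mem hS hmin)))
  have h2 := S.coupling_eq_add (mixed xnew x i (xnew i)) (mixed xnew x i (x i)) y y z z _
    (S.residual_mixed_sub xnew x y i (x i) (xnew i))
  rw [mixed_new, mixed_old, sub_self, inner_zero_left, inner_zero_left] at h2
  rw [blockSubgradient, inner_sub_left, inner_neg_left,
    ContinuousLinearMap.adjoint_inner_left] at h1
  have h3 : 0 ≤ inner ℝ (S.Q i (xnew i - x i)) (xnew i - x i) := by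
    simpa using (hS.Q_pos i).inner_nonneg_left (xnew i - x i)
  have h4 : inner ℝ (S.Q i (xnew i - x i)) (x i - xnew i)
      = -inner ℝ (S.Q i (xnew i - x i)) (xnew i - x i) := by
    rw [← inner_neg_right, neg_sub]
  have h5 := hA (x i - xnew i)
  rw [norm_sub_rev (xnew i)]
  linarith

theorem exists_block_decrease (hS : S.Setting) {L ε₀ : ℝ} {qc εc : Fin p → ℝ}
    (hA4 : S.A4 qc εc) (hσ : 0 < S.sigma L ε₀ qc εc) (i : Fin p) :
    ∃ c : ℝ, 0 < c ∧ ∀ (xnew x : Blocks n) (y : Vec q) (z : Vec m),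
      IsMinOn (S.blockObjective xnew x y z i) Set.univ (xnew i) → S.f i (x i) ≠ ⊤ →
      c * ‖xnew i - x i‖ ^ 2 ≤ (S.f i (x i)).toReal - (S.f i (xnew i)).toReal
        + (S.coupling (sweep xnew x i) y z - S.coupling (sweep xnew x (i + 1)) y z) := by
  obtain ⟨⟨hq0, hQ⟩, hcase⟩ := hA4 i
  rcases hq0.lt_or_eq with hq | hq
  · exact ⟨qc i / 2, half_pos hq, fun _ _ _ _ hmin hx => block_decrease_of_Q hS hQ hmin hx⟩
  · have hf : WeaklyConvex (S.f i) (εc i) := by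
      rcases hcase with h | h
      · exact absurd h (by rw [← hq]; exact lt_irrefl 0)
      · exact h.2
    set T : Vec (n i) →L[ℝ] Vec (n i) :=
      S.α • ((S.A i).adjoint ∘L S.A i) - εc i • ContinuousLinearMap.id ℝ (Vec (n i)) with hT
    have hτ : 0 < minEigenvalue T := by
      have h1 : 0 < S.tauBar qc εc :=
        hσ.trans_le ((min_le_left _ _).trans (min_le_right _ _))
      -- With `qc i = 0`, a positive maximum can only come from its eigenvalue entry.
      have h2 := h1.trans_le (ciInf_le (Set.finite_range _).bddBelow i)
      rw [← hq] at h2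
      exact (lt_max_iff.1 h2).resolve_left (lt_irrefl 0)
    have hinner : ∀ v, inner ℝ v (T v) = S.α * ‖S.A i v‖ ^ 2 - εc i * ‖v‖ ^ 2 := by
      intro v
      rw [hT, sub_apply, smul_apply,
        smul_apply, inner_sub_right, real_inner_smul_right,
        real_inner_smul_right, inner_adjoint_comp_self, ContinuousLinearMap.id_apply,
        real_inner_self_eq_norm_sq]
    have hsymm : (T : Vec (n i) →ₗ[ℝ] Vec (n i)).IsSymmetric := by
      intro u v
      have := isSymmetric_adjoint_comp_self (S.A i) u v
      simp only [ContinuousLinearMap.coe_coe] at this ⊢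
      simp only [hT, sub_apply, smul_apply,
        ContinuousLinearMap.id_apply, inner_sub_left, inner_sub_right, real_inner_smul_left,
        real_inner_smul_right, this]
    refine ⟨_, half_pos hτ, fun _ _ _ _ hmin hx =>
      block_decrease_of_weaklyConvex hS hf (fun v => ?_) hmin hx⟩
    rw [← hinner]
    exact minEigenvalue_mul_norm_sq_le hsymm v

/-! ### The `y`-step -/

theorem y_optimality (hS : S.Setting) {L : NNReal} (hA2 : S.A2 L) {xnew : Blocks n}
    {ynew y : Vec q} {z : Vec m} (hmin : IsMinOn (S.yObjective xnew y z) Set.univ ynew) :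
    gradient S.h ynew + S.B.adjoint (z + S.α • S.residual xnew ynew) + S.P (ynew - y) = 0 := by
  refine eq_zero_of_forall_nonneg_inner_add (C := L / 2 + S.α / 2 * ‖S.B‖ ^ 2 + ‖S.P‖ / 2)
    fun d => ?_
  have h0 : S.yObjective xnew y z ynew ≤ S.yObjective xnew y z (ynew + d) := hmin (Set.mem_univ _)
  have h1 := S.coupling_eq_add xnew xnew ynew (ynew + d) z z (S.B d)
    (by rw [residual_sub, sub_self, add_sub_cancel_left]; simp [Amul])
  have h2 := inner_quadratic_add hS.P_pos.isSymmetric (ynew - y) d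
  rw [sub_add_eq_add_sub] at h2
  have h3 := (abs_le.1 (abs_sub_sub_inner_le_of_lipschitzWith_gradient hA2.2.1 hA2.2.2
    ynew (ynew + d))).2
  rw [add_sub_cancel_left] at h3
  rw [yObjective, yObjective, h1, h2, sub_self, inner_zero_left, inner_zero_left] at h0
  rw [inner_add_left, inner_add_left, ContinuousLinearMap.adjoint_inner_left]
  have h4 := mul_le_mul_of_nonneg_left (norm_sq_apply_le S.B d) (half_pos hS.α_pos).le
  have h5 := inner_quadratic_le S.P d
  linarith

/-- Using the optimality equation instead of comparing objective values gains a second copy of the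
proximal term and the term `α Bᵀ B`; the descent inequality for `h` costs `L`. This is the origin of
`D`. -/
theorem y_decrease (hS : S.Setting) {L : NNReal} (hA2 : S.A2 L) {xnew : Blocks n}
    {ynew y : Vec q} {z : Vec m} (hmin : IsMinOn (S.yObjective xnew y z) Set.univ ynew) :
    1 / 2 * inner ℝ (ynew - y) (S.D L (ynew - y)) ≤
      S.h y + S.coupling xnew y z - (S.h ynew + S.coupling xnew ynew z) := by
  have h0 := congrArg (fun w => inner ℝ w (y - ynew)) (y_optimality hS hA2 hmin)
  simp only [inner_add_left, inner_zero_left, ContinuousLinearMap.adjoint_inner_left] at h0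
  have h1 := S.coupling_eq_add xnew xnew ynew y z z (S.B (y - ynew))
    (by rw [residual_sub, sub_self]; simp [Amul])
  rw [sub_self, inner_zero_left, inner_zero_left, inner_add_left] at h1
  have h2 := neg_le_sub_sub_inner_of_lipschitzWith_gradient hA2.2.1 hA2.2.2 ynew y
  have h3 : inner ℝ (ynew - y) (S.D L (ynew - y)) =
      2 * inner ℝ (ynew - y) (S.P (ynew - y)) + S.α * ‖S.B (ynew - y)‖ ^ 2
        - L * ‖ynew - y‖ ^ 2 := by
    rw [D, sub_apply, add_apply,
      smul_apply, smul_apply,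
      smul_apply, inner_sub_right, inner_add_right, real_inner_smul_right,
      real_inner_smul_right, real_inner_smul_right, BtB, inner_adjoint_comp_self,
      ContinuousLinearMap.id_apply, real_inner_self_eq_norm_sq]
  have h4 : inner ℝ (S.P (ynew - y)) (y - ynew) = -inner ℝ (ynew - y) (S.P (ynew - y)) := by
    rw [real_inner_comm, ← inner_neg_left, neg_sub]
  have h5 : ‖S.B (y - ynew)‖ = ‖S.B (ynew - y)‖ := by
    rw [← neg_sub, map_neg, norm_neg]
  rw [norm_sub_rev y] at h2
  rw [h5] at h1
  rw [h3]
  linarith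

theorem exists_Dbar_bound (hS : S.Setting) {L : NNReal} {ε₀ : ℝ} {qc εc : Fin p → ℝ}
    (hσ : 0 < S.sigma L ε₀ qc εc) :
    ∃ c : ℝ, 0 < c ∧ ∀ w : Vec q,
      c * ‖w‖ ^ 2 + ε₀ * (S.c₃ + S.c₄ L) * ‖w‖ ^ 2 ≤ 1 / 2 * inner ℝ w (S.D L w) := by
  have hpos : 0 < minEigenvalue (S.Dbar L ε₀) :=
    hσ.trans_le ((min_le_left _ _).trans (min_le_left _ _))
  have hsymm : (S.Dbar L ε₀ : Vec q →ₗ[ℝ] Vec q).IsSymmetric := by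
    intro u v
    have h1 := isSymmetric_adjoint_comp_self S.B u v
    have h2 := hS.P_pos.isSymmetric u v
    simp only [ContinuousLinearMap.coe_coe] at h1 h2 ⊢
    simp only [Dbar, D, BtB, sub_apply, add_apply,
      smul_apply, ContinuousLinearMap.id_apply, inner_sub_left,
      inner_sub_right, inner_add_left, inner_add_right, real_inner_smul_left,
      real_inner_smul_right, h1, h2]
  refine ⟨_, half_pos hpos, fun w => ?_⟩
  have h := minEigenvalue_mul_norm_sq_le hsymm w
  have h' : inner ℝ w (S.Dbar L ε₀ w) =
      inner ℝ w (S.D L w) - 2 * ε₀ * (S.c₃ + S.c₄ L) * ‖w‖ ^ 2 := by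
    rw [Dbar, sub_apply, smul_apply, inner_sub_right,
      real_inner_smul_right, ContinuousLinearMap.id_apply, real_inner_self_eq_norm_sq]
  rw [h'] at h
  linarith

end PADMM
-- Cauchy–Schwarz gives a factor `3` for the three summands and `p` for the blocks; `p + 1` also
-- covers the summands `b` and `c`.
theorem sq_sum_add_add_le {p : ℕ} (a : Fin p → ℝ) (b c : ℝ) :
    (∑ i, a i + b + c) ^ 2 ≤ 3 * (p + 1) * (∑ i, a i ^ 2 + b ^ 2 + c ^ 2) := by
  have h1 := sq_sum_le_card_mul_sum_sq (s := Finset.univ) (f := a)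
  rw [Finset.card_univ, Fintype.card_fin] at h1
  have h2 : (∑ i, a i + b + c) ^ 2 ≤ 3 * ((∑ i, a i) ^ 2 + b ^ 2 + c ^ 2) := by
    nlinarith [sq_nonneg (∑ i, a i - b), sq_nonneg (∑ i, a i - c), sq_nonneg (b - c)]
  have h3 : 0 ≤ ∑ i, a i ^ 2 := Finset.sum_nonneg fun i _ => sq_nonneg _
  have hp : (0 : ℝ) ≤ p := Nat.cast_nonneg p
  nlinarith [mul_nonneg hp (sq_nonneg b), mul_nonneg hp (sq_nonneg c)]

namespace PADMM

variable {p : ℕ} {n : Fin p → ℕ} {q m : ℕ} {S : PADMM n q m}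

theorem residual_mem_range (hA3 : S.A3) (x : Blocks n) (y : Vec q) :
    S.residual x y ∈ Set.range S.B := by
  obtain ⟨u, hu⟩ := hA3.1 ⟨x, rfl⟩
  obtain ⟨v, hv⟩ := hA3.2
  exact ⟨u + y + v, by rw [map_add, map_add, hu, hv, residual]⟩

theorem rho_pos (hS : S.Setting) : 0 < S.rho := by
  have h1 := hS.β_pos
  have h2 := hS.β_lt
  have : |1 - S.β| < 1 := abs_lt.2 ⟨by linarith, by linarith⟩
  rw [rho]
  linarith

theorem minPosEigenvalue_BtB_pos (hS : S.Setting) : 0 < minPosEigenvalue S.BtB :=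
  minPosEigenvalue_adjoint_comp_self_pos hS.B_ne

theorem c₃_nonneg (hS : S.Setting) : 0 ≤ S.c₃ := by
  have := minPosEigenvalue_BtB_pos hS
  have := hS.α_pos
  have := hS.β_pos
  rw [c₃, c₂]
  positivity

theorem c₅_nonneg (hS : S.Setting) : 0 ≤ S.c₅ := by
  have := minPosEigenvalue_BtB_pos hS
  have := hS.α_pos
  have := hS.β_pos
  have := rho_pos hS
  rw [c₅, c₁]
  positivity

variable {x : ℕ → Blocks n} {y : ℕ → Vec q} {z : ℕ → Vec m}

/-! ### The dual step -/

theorem dual_recursion (hS : S.Setting) {L : NNReal} (hA2 : S.A2 L) (hseq : S.IsSequence x y z)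
    (k : ℕ) :
    S.B.adjoint (z (k + 2) - z (k + 1)) = (1 - S.β) • S.B.adjoint (z (k + 1) - z k)
      - S.β • (gradient S.h (y (k + 2)) - gradient S.h (y (k + 1))
        + (S.P (y (k + 2) - y (k + 1)) - S.P (y (k + 1) - y k))) := by
  -- The dual step makes `Bᵀ Δz` equal to `β` times the penalty term of the `y`-optimality
  -- condition. Subtracting two consecutive instances gives the recursion.
  have key : ∀ k, S.B.adjoint (z (k + 1) - z k) = -(S.β • (gradient S.h (y (k + 1))
      + S.B.adjoint (z k) + S.P (y (k + 1) - y k))) := by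
    intro k
    have h1 := y_optimality hS hA2 (hseq.y_step k)
    have h2 : S.B.adjoint (z (k + 1) - z k) =
        S.β • S.B.adjoint (S.α • S.residual (x (k + 1)) (y (k + 1))) := by
      rw [hseq.z_step k, add_sub_cancel_left, ← map_smul, smul_smul, mul_comm]
    rw [h2, ← smul_neg]
    congr 1
    rw [map_add] at h1
    rw [eq_neg_iff_add_eq_zero, ← h1]
    abel
  have h1 := key (k + 1)
  have h0 := key k
  have h3 : S.B.adjoint (z (k + 1) - z k) = S.B.adjoint (z (k + 1)) - S.B.adjoint (z k) :=
    map_sub _ _ _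
  have h4 : (1 - S.β) • S.B.adjoint (z (k + 1) - z k) = S.B.adjoint (z (k + 1) - z k)
      - S.β • (S.B.adjoint (z (k + 1)) - S.B.adjoint (z k)) := by
    rw [← h3, sub_smul, one_smul]
  rw [h4, h1, h0]
  module

/-- The bound `‖Bᵀ Δz⁺‖ ≤ |1 - β| ‖Bᵀ Δz‖ + …` is squared by convexity with weights `1 - ρ` and `ρ`.
Subtracting `|1 - β| ‖Bᵀ Δz⁺‖²` from both sides leaves the factor `ρ` on the left and a telescoping
difference on the right. -/
theorem dual_bound (hS : S.Setting) {L : NNReal} (hA2 : S.A2 L) (hA3 : S.A3)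
    (hseq : S.IsSequence x y z) (k : ℕ) :
    1 / (S.α * S.β) * ‖z (k + 2) - z (k + 1)‖ ^ 2 ≤
      S.c₅ * (‖S.B.adjoint (z (k + 1) - z k)‖ ^ 2 - ‖S.B.adjoint (z (k + 2) - z (k + 1))‖ ^ 2)
        + S.c₄ L * ‖y (k + 2) - y (k + 1)‖ ^ 2 + S.c₃ * ‖y (k + 1) - y k‖ ^ 2 := by
  have hα := hS.α_pos
  have hβ := hS.β_pos
  have hρ := rho_pos hS
  have hlam := minPosEigenvalue_BtB_pos hS
  have hrange : z (k + 2) - z (k + 1) ∈ Set.range S.B := by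
    obtain ⟨u, hu⟩ := residual_mem_range hA3 (x (k + 2)) (y (k + 2))
    exact ⟨(S.α * S.β) • u, by rw [map_smul, hu, hseq.z_step (k + 1), add_sub_cancel_left]⟩
  have hz := minPosEigenvalue_mul_norm_sq_le S.B hrange
  have hnorm : ‖S.B.adjoint (z (k + 2) - z (k + 1))‖ ≤
      |1 - S.β| * ‖S.B.adjoint (z (k + 1) - z k)‖ + S.β * ((‖S.P‖ + L) * ‖y (k + 2) - y (k + 1)‖
        + ‖S.P‖ * ‖y (k + 1) - y k‖) := by
    rw [dual_recursion hS hA2 hseq k]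
    refine (norm_sub_le _ _).trans ?_
    rw [norm_smul, norm_smul, Real.norm_eq_abs, Real.norm_eq_abs, abs_of_pos hβ]
    gcongr
    have h1 := hA2.2.2.dist_le_mul (y (k + 2)) (y (k + 1))
    rw [dist_eq_norm, dist_eq_norm] at h1
    have h2 := S.P.le_opNorm (y (k + 2) - y (k + 1))
    have h3 := S.P.le_opNorm (y (k + 1) - y k)
    refine (norm_add_le _ _).trans ?_
    have h4 := norm_sub_le (S.P (y (k + 2) - y (k + 1))) (S.P (y (k + 1) - y k))
    linarith
  change minPosEigenvalue S.BtB * _ ≤ _ at hz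
  set lam := minPosEigenvalue S.BtB
  set a := ‖S.B.adjoint (z (k + 1) - z k)‖
  set a' := ‖S.B.adjoint (z (k + 2) - z (k + 1))‖
  set u' := ‖y (k + 2) - y (k + 1)‖
  set u := ‖y (k + 1) - y k‖
  set N := ‖S.P‖
  set t := |1 - S.β| with ht
  set ρ := S.rho with hρdef
  have htρ : t = 1 - ρ := by rw [hρdef, rho]; ring
  -- Dividing by `ρ` turns the right-hand side into the convex combination `t * a + ρ * e`.
  set e := S.β * ((N + L) * u' + N * u) / ρ with he
  have hρe : S.β * ((N + L) * u' + N * u) = ρ * e := by rw [he]; field_simp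
  have ht0 : 0 ≤ t := abs_nonneg _
  have h1 : a' ^ 2 ≤ t * a ^ 2 + ρ * e ^ 2 := by
    rw [hρe] at hnorm
    have h2 : a' ^ 2 ≤ (t * a + ρ * e) ^ 2 := by
      have : 0 ≤ a' := norm_nonneg _
      gcongr
    have h3 : t * a ^ 2 + ρ * e ^ 2 - (t * a + ρ * e) ^ 2 = t * ρ * (a - e) ^ 2 := by
      rw [htρ]; ring
    have h4 : 0 ≤ t * ρ * (a - e) ^ 2 := by positivity
    linarith
  have h2 : ρ * e ^ 2 ≤ 2 * S.β ^ 2 / ρ * ((N + L) ^ 2 * u' ^ 2 + N ^ 2 * u ^ 2) := by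
    have h3 : ρ * e ^ 2 = S.β ^ 2 / ρ * ((N + L) * u' + N * u) ^ 2 := by
      rw [he]; field_simp
    have h4 : ((N + L) * u' + N * u) ^ 2 ≤ 2 * ((N + L) ^ 2 * u' ^ 2 + N ^ 2 * u ^ 2) := by
      nlinarith [sq_nonneg ((N + L) * u' - N * u)]
    calc ρ * e ^ 2 = S.β ^ 2 / ρ * ((N + L) * u' + N * u) ^ 2 := h3
      _ ≤ S.β ^ 2 / ρ * (2 * ((N + L) ^ 2 * u' ^ 2 + N ^ 2 * u ^ 2)) := by gcongr
      _ = _ := by ring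
  have h3 : ρ * (lam * ‖z (k + 2) - z (k + 1)‖ ^ 2) ≤
      t * (a ^ 2 - a' ^ 2) + 2 * S.β ^ 2 / ρ * ((N + L) ^ 2 * u' ^ 2 + N ^ 2 * u ^ 2) := by
    have : ρ * (lam * ‖z (k + 2) - z (k + 1)‖ ^ 2) ≤ ρ * a' ^ 2 := by gcongr
    have h4 : ρ * a' ^ 2 = a' ^ 2 - t * a' ^ 2 := by rw [htρ]; ring
    linarith
  -- This factor normalises the left side to the exact ascent of the dual step; on the right it
  -- produces `c₃`, `c₄` and `c₅`.
  have hK : 0 < 1 / (S.α * S.β * lam * ρ) := by positivity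
  have h4 := mul_le_mul_of_nonneg_left h3 hK.le
  have e1 : 1 / (S.α * S.β * lam * ρ) * (ρ * (lam * ‖z (k + 2) - z (k + 1)‖ ^ 2)) =
      1 / (S.α * S.β) * ‖z (k + 2) - z (k + 1)‖ ^ 2 := by field_simp
  have e2 : 1 / (S.α * S.β * lam * ρ) * (t * (a ^ 2 - a' ^ 2) +
      2 * S.β ^ 2 / ρ * ((N + L) ^ 2 * u' ^ 2 + N ^ 2 * u ^ 2)) =
      S.c₅ * (a ^ 2 - a' ^ 2) + S.c₄ L * u' ^ 2 + S.c₃ * u ^ 2 := by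
    change _ = S.β⁻¹ * t * (1 / (S.α * ρ * lam)) * (a ^ 2 - a' ^ 2)
      + 2 * S.β / (S.α * ρ ^ 2 * lam) * (N + L) ^ 2 * u' ^ 2
      + 2 * S.β / (S.α * ρ ^ 2 * lam) * N ^ 2 * u ^ 2
    field_simp
    ring
  rw [e1, e2] at h4
  exact h4

/-! ### Decrease of the modified augmented Lagrangian -/

/-- Finiteness comes from having minimised, so it is known only from index `1` on; the starting
blocks may have value `+∞`. Hence `lyapunov` begins at the first computed iterate. -/
theorem f_ne_top (hS : S.Setting) (hseq : S.IsSequence x y z) (k : ℕ) (i : Fin p) :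
    S.f i (x (k + 1) i) ≠ ⊤ :=
  blockObjective_ne_top hS (hseq.x_step k i)

/-- The real value of the modified augmented Lagrangian along the sequence. -/
noncomputable def lyapunov (S : PADMM n q m) (ε₀ : ℝ) (x : ℕ → Blocks n) (y : ℕ → Vec q)
    (z : ℕ → Vec m) (k : ℕ) : ℝ :=
  ∑ i, (S.f i (x (k + 1) i)).toReal
    + (S.h (y (k + 1)) + S.coupling (x (k + 1)) (y (k + 1)) (z (k + 1)))
    + (ε₀ * S.c₅ * ‖S.B.adjoint (z (k + 1) - z k)‖ ^ 2 + ε₀ * S.c₃ * ‖y (k + 1) - y k‖ ^ 2)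

/-- The total length of the `k`-th step, summed over the blocks. -/
noncomputable def stepLength (x : ℕ → Blocks n) (y : ℕ → Vec q) (z : ℕ → Vec m) (k : ℕ) : ℝ :=
  (∑ i, ‖x (k + 1) i - x k i‖) + ‖y (k + 1) - y k‖ + ‖z (k + 1) - z k‖

theorem stepLength_nonneg (k : ℕ) : 0 ≤ stepLength x y z k := by
  rw [stepLength]
  positivity

theorem modLagrangian_eq_lyapunov (hS : S.Setting) (hseq : S.IsSequence x y z) (ε₀ : ℝ) (k : ℕ) :
    S.modLagrangian ε₀ (quintuple (x (k + 1)) (y (k + 1)) (z (k + 1)) (y k) (z k)) =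
      (S.lyapunov ε₀ x y z k : EReal) := by
  rw [lyapunov, EReal.coe_add, EReal.coe_add, EReal.coe_sum_real]
  simp only [EReal.coe_toReal (f_ne_top hS hseq k _) (hS.f_ne_bot _ _)]
  rfl

theorem exists_lyapunov_decrease (hp : 1 ≤ p) (hS : S.Setting) {L : NNReal} {ε₀ : ℝ}
    {qc εc : Fin p → ℝ} (hA2 : S.A2 L) (hA3 : S.A3) (hA4 : S.A4 qc εc) (hε₀ : 1 < ε₀)
    (hσ : 0 < S.sigma L ε₀ qc εc) (hseq : S.IsSequence x y z) :
    ∃ a : ℝ, 0 < a ∧ ∀ k, a * stepLength x y z (k + 1) ^ 2 ≤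
      S.lyapunov ε₀ x y z k - S.lyapunov ε₀ x y z (k + 1) := by
  have : Nonempty (Fin p) := ⟨⟨0, hp⟩⟩
  choose c hc hblock using exists_block_decrease hS hA4 hσ
  obtain ⟨i₀, hi₀⟩ := Finite.exists_min c
  obtain ⟨d, hd, hDbar⟩ := exists_Dbar_bound hS hσ
  have hα := hS.α_pos
  have hβ := hS.β_pos
  set e := (ε₀ - 1) / (S.α * S.β) with he
  have he0 : 0 < e := div_pos (sub_pos.2 hε₀) (mul_pos hα hβ)
  set s := min (c i₀) (min d e)
  have hs : 0 < s := lt_min (hc _) (lt_min hd he0)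
  refine ⟨s / (3 * (p + 1)), by positivity, fun k => ?_⟩
  have hx : s * ∑ i, ‖x (k + 2) i - x (k + 1) i‖ ^ 2 ≤
      ∑ i, (S.f i (x (k + 1) i)).toReal - ∑ i, (S.f i (x (k + 2) i)).toReal
        + (S.coupling (x (k + 1)) (y (k + 1)) (z (k + 1))
          - S.coupling (x (k + 2)) (y (k + 1)) (z (k + 1))) := by
    have h1 : ∀ i : Fin p, s * ‖x (k + 2) i - x (k + 1) i‖ ^ 2 ≤ _ := fun i =>
      (mul_le_mul_of_nonneg_right ((min_le_left _ _).trans (hi₀ i)) (sq_nonneg _)).trans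
        (hblock i (x (k + 2)) (x (k + 1)) (y (k + 1)) (z (k + 1)) (hseq.x_step (k + 1) i)
          (f_ne_top hS hseq k i))
    -- The coupling differences telescope along the sweep, from the old block vector to the new one.
    have h2 := Finset.sum_le_sum fun i (_ : i ∈ Finset.univ) => h1 i
    rw [← Finset.mul_sum, Finset.sum_add_distrib, Finset.sum_sub_distrib,
      Fin.sum_univ_eq_sum_range (fun j => S.coupling (sweep (x (k + 2)) (x (k + 1)) j)
        (y (k + 1)) (z (k + 1)) - S.coupling (sweep (x (k + 2)) (x (k + 1)) (j + 1))
        (y (k + 1)) (z (k + 1))) p, Finset.sum_range_sub', sweep_zero, sweep_card] at h2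
    exact h2
  have hy := y_decrease hS hA2 (hseq.y_step (k + 1))
  have hyD := hDbar (y (k + 2) - y (k + 1))
  have hz : S.coupling (x (k + 2)) (y (k + 2)) (z (k + 2)) =
      S.coupling (x (k + 2)) (y (k + 2)) (z (k + 1))
        + 1 / (S.α * S.β) * ‖z (k + 2) - z (k + 1)‖ ^ 2 := by
    rw [S.coupling_eq_add (x (k + 2)) (x (k + 2)) (y (k + 2)) (y (k + 2)) (z (k + 1)) (z (k + 2)) 0
      (sub_self _), hseq.z_step (k + 1), add_sub_cancel_left, real_inner_smul_left,
      real_inner_self_eq_norm_sq, norm_smul, Real.norm_eq_abs, abs_of_pos (mul_pos hα hβ)]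
    simp only [inner_zero_right, norm_zero]
    field_simp
    ring
  -- One of the `ε₀` copies cancels the ascent `hz`; the other `ε₀ - 1` provide the decrease in `z`
  -- with constant `e`. The `c₃` term at the previous `y`-step is paid by the old Lyapunov value.
  have hdual := mul_le_mul_of_nonneg_left (dual_bound hS hA2 hA3 hseq k) (zero_lt_one.trans hε₀).le
  have hez : e * ‖z (k + 2) - z (k + 1)‖ ^ 2 = ε₀ * (1 / (S.α * S.β)
      * ‖z (k + 2) - z (k + 1)‖ ^ 2) - 1 / (S.α * S.β) * ‖z (k + 2) - z (k + 1)‖ ^ 2 := by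
    rw [he]; ring
  have hsz : s * ‖z (k + 2) - z (k + 1)‖ ^ 2 ≤ e * ‖z (k + 2) - z (k + 1)‖ ^ 2 :=
    mul_le_mul_of_nonneg_right ((min_le_right _ _).trans (min_le_right _ _)) (sq_nonneg _)
  have hsy : s * ‖y (k + 2) - y (k + 1)‖ ^ 2 ≤ d * ‖y (k + 2) - y (k + 1)‖ ^ 2 :=
    mul_le_mul_of_nonneg_right ((min_le_right _ _).trans (min_le_left _ _)) (sq_nonneg _)
  have hsq := sq_sum_add_add_le (fun i => ‖x (k + 2) i - x (k + 1) i‖) ‖y (k + 2) - y (k + 1)‖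
    ‖z (k + 2) - z (k + 1)‖
  calc s / (3 * (p + 1)) * stepLength x y z (k + 1) ^ 2
      ≤ s / (3 * (p + 1)) * (3 * (p + 1) * (∑ i, ‖x (k + 2) i - x (k + 1) i‖ ^ 2
        + ‖y (k + 2) - y (k + 1)‖ ^ 2 + ‖z (k + 2) - z (k + 1)‖ ^ 2)) :=
        mul_le_mul_of_nonneg_left hsq (by positivity)
    _ = s * ∑ i, ‖x (k + 2) i - x (k + 1) i‖ ^ 2 + s * ‖y (k + 2) - y (k + 1)‖ ^ 2
        + s * ‖z (k + 2) - z (k + 1)‖ ^ 2 := by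
        field_simp
    _ ≤ _ := by
        simp only [lyapunov, show k + 1 + 1 = k + 2 from rfl] at hy ⊢
        rw [hz]
        linarith

end PADMM
-- Subgradients of the modified augmented Lagrangian
theorem WithLp.norm_fst_le_two {E F : Type*} [SeminormedAddCommGroup E] [SeminormedAddCommGroup F]
    (v : WithLp 2 (E × F)) : ‖v.fst‖ ≤ ‖v‖ := by
  rw [WithLp.prod_norm_eq_of_L2]
  exact Real.le_sqrt_of_sq_le (le_add_of_nonneg_right (sq_nonneg _))

theorem WithLp.norm_snd_le_two {E F : Type*} [SeminormedAddCommGroup E] [SeminormedAddCommGroup F]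
    (v : WithLp 2 (E × F)) : ‖v.snd‖ ≤ ‖v‖ := by
  rw [WithLp.prod_norm_eq_of_L2]
  exact Real.le_sqrt_of_sq_le (le_add_of_nonneg_left (sq_nonneg _))

namespace PADMM

variable {p : ℕ} {n : Fin p → ℕ} {q m : ℕ} {S : PADMM n q m}

theorem norm_triple_le (X : Blocks n) (Y : Vec q) (Z : Vec m) :
    ‖triple X Y Z‖ ≤ ∑ i, ‖X i‖ + ‖Y‖ + ‖Z‖ := by
  have h1 := WithLp.norm_toLp_prod_le X (WithLp.toLp 2 (Y, Z))
  have h2 := WithLp.norm_toLp_prod_le Y Z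
  have h3 := PiLp.norm_le_sum_norm X
  rw [triple]
  linarith

theorem norm_quintuple_le (X : Blocks n) (Y : Vec q) (Z : Vec m) (Y' : Vec q) (Z' : Vec m) :
    ‖quintuple X Y Z Y' Z'‖ ≤ ∑ i, ‖X i‖ + ‖Y‖ + ‖Z‖ + ‖Y'‖ + ‖Z'‖ := by
  have h1 := WithLp.norm_toLp_prod_le (triple X Y Z) (WithLp.toLp 2 (Y', Z'))
  have h2 := WithLp.norm_toLp_prod_le Y' Z'
  have h3 := norm_triple_le X Y Z
  rw [quintuple]
  linarith

theorem inner_quintuple (X : Blocks n) (Y : Vec q) (Z : Vec m) (Y' : Vec q) (Z' : Vec m)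
    (d : Quintuple n q m) :
    inner ℝ (quintuple X Y Z Y' Z') d = ∑ i, inner ℝ (X i) (d.fst.fst i)
      + inner ℝ Y d.fst.snd.fst + inner ℝ Z d.fst.snd.snd + inner ℝ Y' d.snd.fst
      + inner ℝ Z' d.snd.snd := by
  rw [quintuple, triple, WithLp.prod_inner_apply, WithLp.prod_inner_apply, WithLp.prod_inner_apply,
    WithLp.prod_inner_apply, PiLp.inner_apply]
  simp only [WithLp.fst, WithLp.snd]
  ring

variable (S) in
/-- A bound for the operator `(x, y) ↦ A x + B y`. -/
noncomputable def constraintNorm : ℝ := ∑ i, ‖S.A i‖ + ‖S.B‖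

variable (S) in
theorem constraintNorm_nonneg : 0 ≤ S.constraintNorm := by
  rw [constraintNorm]
  positivity

variable (S) in
theorem norm_Amul_add_le {x : Blocks n} {y : Vec q} {r : ℝ} (hx : ∀ i, ‖x i‖ ≤ r) (hy : ‖y‖ ≤ r) :
    ‖S.Amul x + S.B y‖ ≤ S.constraintNorm * r := by
  rw [constraintNorm, add_mul, Finset.sum_mul]
  refine (norm_add_le _ _).trans (add_le_add ((norm_sum_le _ _).trans ?_)
    ((S.B.le_opNorm y).trans (by gcongr)))
  exact Finset.sum_le_sum fun i _ => ((S.A i).le_opNorm (x i)).trans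
    (mul_le_mul_of_nonneg_left (hx i) (norm_nonneg _))

variable (S) in
/-- The subgradient of the modified augmented Lagrangian built from subgradients `s i` of the
block functions. -/
noncomputable def modSubgradient (ε₀ : ℝ) (s : ∀ i, Vec (n i)) (X : Blocks n) (Y : Vec q)
    (Z : Vec m) (Y' : Vec q) (Z' : Vec m) : Quintuple n q m :=
  quintuple (WithLp.toLp 2 fun i => s i + (S.A i).adjoint (Z + S.α • S.residual X Y))
    (gradient S.h Y + S.B.adjoint (Z + S.α • S.residual X Y) + (2 * (ε₀ * S.c₃)) • (Y - Y'))
    (S.residual X Y + (2 * (ε₀ * S.c₅)) • S.B (S.B.adjoint (Z - Z')))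
    (-((2 * (ε₀ * S.c₃)) • (Y - Y')))
    (-((2 * (ε₀ * S.c₅)) • S.B (S.B.adjoint (Z - Z'))))

/-- Squares of increments are nonnegative and are dropped. Only two quadratic errors remain: `L / 2`
from `h`, and the bilinear term pairing the increment of `Z` with that of the residual, bounded by
`constraintNorm`. -/
theorem smooth_part_minorant {L : NNReal} (hA2 : S.A2 L) (hα : 0 ≤ S.α) {a b : ℝ}
    (ha : 0 ≤ a) (hb : 0 ≤ b) (X X₁ : Blocks n) (Y Y₁ Y' Y₁' : Vec q) (Z Z₁ Z' Z₁' : Vec m)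
    {r : ℝ} (hX : ∀ i, ‖X₁ i - X i‖ ≤ r) (hY : ‖Y₁ - Y‖ ≤ r) (hZ : ‖Z₁ - Z‖ ≤ r) :
    (S.h Y + S.coupling X Y Z) + (a * ‖S.B.adjoint (Z - Z')‖ ^ 2 + b * ‖Y - Y'‖ ^ 2)
      + (∑ i, inner ℝ ((S.A i).adjoint (Z + S.α • S.residual X Y)) (X₁ i - X i)
        + inner ℝ (gradient S.h Y + S.B.adjoint (Z + S.α • S.residual X Y)
            + (2 * b) • (Y - Y')) (Y₁ - Y)
        + inner ℝ (S.residual X Y + (2 * a) • S.B (S.B.adjoint (Z - Z'))) (Z₁ - Z)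
        + inner ℝ (-((2 * b) • (Y - Y'))) (Y₁' - Y')
        + inner ℝ (-((2 * a) • S.B (S.B.adjoint (Z - Z')))) (Z₁' - Z')
        - (L / 2 + S.constraintNorm) * r ^ 2) ≤
      (S.h Y₁ + S.coupling X₁ Y₁ Z₁)
        + (a * ‖S.B.adjoint (Z₁ - Z₁')‖ ^ 2 + b * ‖Y₁ - Y₁'‖ ^ 2) := by
  have hr : 0 ≤ r := (norm_nonneg _).trans hY
  have h1 := neg_le_sub_sub_inner_of_lipschitzWith_gradient hA2.2.1 hA2.2.2 Y Y₁
  have h2 := S.coupling_eq_add X X₁ Y Y₁ Z Z₁ _ (S.residual_sub X X₁ Y Y₁)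
  have h3 : -(S.constraintNorm * r ^ 2) ≤
      inner ℝ (Z₁ - Z) (S.Amul (X₁ - X) + S.B (Y₁ - Y)) := by
    refine neg_le_of_abs_le ((abs_real_inner_le_norm _ _).trans ?_)
    calc ‖Z₁ - Z‖ * ‖S.Amul (X₁ - X) + S.B (Y₁ - Y)‖ ≤ r * (S.constraintNorm * r) := by
          gcongr
          exact S.norm_Amul_add_le hX hY
      _ = _ := by ring
  have h4 : inner ℝ (Z + S.α • S.residual X Y) (S.Amul (X₁ - X) + S.B (Y₁ - Y)) =
      ∑ i, inner ℝ ((S.A i).adjoint (Z + S.α • S.residual X Y)) (X₁ i - X i)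
        + inner ℝ (S.B.adjoint (Z + S.α • S.residual X Y)) (Y₁ - Y) := by
    simp only [ContinuousLinearMap.adjoint_inner_left]
    rw [inner_add_right, Amul, inner_sum]
    rfl
  have h5 : ‖Y - Y'‖ ^ 2 + 2 * inner ℝ (Y - Y') ((Y₁ - Y) - (Y₁' - Y')) ≤ ‖Y₁ - Y₁'‖ ^ 2 := by
    rw [show Y₁ - Y₁' = (Y - Y') + ((Y₁ - Y) - (Y₁' - Y')) by abel, norm_add_sq_real]
    linarith [sq_nonneg ‖(Y₁ - Y) - (Y₁' - Y')‖]
  have h6 : ‖S.B.adjoint (Z - Z')‖ ^ 2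
      + 2 * inner ℝ (S.B (S.B.adjoint (Z - Z'))) ((Z₁ - Z) - (Z₁' - Z')) ≤
        ‖S.B.adjoint (Z₁ - Z₁')‖ ^ 2 := by
    rw [show Z₁ - Z₁' = (Z - Z') + ((Z₁ - Z) - (Z₁' - Z')) by abel, map_add, norm_add_sq_real,
      ← ContinuousLinearMap.adjoint_inner_right]
    linarith [sq_nonneg ‖S.B.adjoint ((Z₁ - Z) - (Z₁' - Z'))‖]
  have h5' := mul_le_mul_of_nonneg_left h5 hb
  have h6' := mul_le_mul_of_nonneg_left h6 ha
  have h7 : L / 2 * ‖Y₁ - Y‖ ^ 2 ≤ L / 2 * r ^ 2 := by gcongr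
  have h8 : 0 ≤ S.α / 2 * ‖S.Amul (X₁ - X) + S.B (Y₁ - Y)‖ ^ 2 := by positivity
  rw [inner_sub_right] at h5' h6'
  simp only [inner_add_left, inner_neg_left, real_inner_smul_left]
  rw [inner_add_left] at h4
  rw [h2, inner_add_left, h4, real_inner_comm (S.residual X Y) (Z₁ - Z)]
  linarith

/-- Global quadratic minorants of the blocks and of the smooth part add up to one of the sum,
touching at the same point, so no subdifferential calculus is needed. -/
theorem modSubgradient_mem (hS : S.Setting) {L : NNReal} (hA2 : S.A2 L) {ε₀ : ℝ} (hε₀ : 0 ≤ ε₀)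
    {s : ∀ i, Vec (n i)} {X : Blocks n} {Y : Vec q} {Z : Vec m} {Y' : Vec q} {Z' : Vec m}
    (hfin : ∀ i, S.f i (X i) ≠ ⊤) (C : Fin p → ℝ) (hC : ∀ i, 0 ≤ C i)
    (hs : ∀ i v, S.f i (X i) + ((inner ℝ (s i) (v - X i) - C i * ‖v - X i‖ ^ 2 : ℝ) : EReal) ≤
      S.f i v) :
    S.modSubgradient ε₀ s X Y Z Y' Z' ∈
      frechetSubdiff (S.modLagrangian ε₀) (quintuple X Y Z Y' Z') := by
  have hval : S.modLagrangian ε₀ (quintuple X Y Z Y' Z') =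
      ∑ i, S.f i (X i) + (((S.h Y + S.coupling X Y Z)
        + (ε₀ * S.c₅ * ‖S.B.adjoint (Z - Z')‖ ^ 2 + ε₀ * S.c₃ * ‖Y - Y'‖ ^ 2) : ℝ) : EReal) := by
    rw [EReal.coe_add, ← add_assoc]
    rfl
  have htop : S.modLagrangian ε₀ (quintuple X Y Z Y' Z') ≠ ⊤ := by
    have h1 : ∀ i, ((S.f i (X i)).toReal : EReal) = S.f i (X i) := fun i =>
      EReal.coe_toReal (hfin i) (hS.f_ne_bot _ _)
    rw [hval, ← Finset.sum_congr rfl fun i _ => h1 i, ← EReal.coe_sum_real, ← EReal.coe_add]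
    exact EReal.coe_ne_top _
  refine mem_frechetSubdiff_of_quadratic_minorant htop (∑ i, C i + (L / 2 + S.constraintNorm))
    fun w => ?_
  set r := ‖w - quintuple X Y Z Y' Z'‖ with hr
  have hx : ∀ i, ‖w.fst.fst i - X i‖ ≤ r := fun i =>
    (PiLp.norm_apply_le (w.fst.fst - X) i).trans
      ((WithLp.norm_fst_le_two (w.fst - triple X Y Z)).trans
        (WithLp.norm_fst_le_two (w - quintuple X Y Z Y' Z')))
  have hy : ‖w.fst.snd.fst - Y‖ ≤ r :=
    (WithLp.norm_fst_le_two (w.fst - triple X Y Z).snd).trans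
      ((WithLp.norm_snd_le_two (w.fst - triple X Y Z)).trans
        (WithLp.norm_fst_le_two (w - quintuple X Y Z Y' Z')))
  have hz : ‖w.fst.snd.snd - Z‖ ≤ r :=
    (WithLp.norm_snd_le_two (w.fst - triple X Y Z).snd).trans
      ((WithLp.norm_snd_le_two (w.fst - triple X Y Z)).trans
        (WithLp.norm_fst_le_two (w - quintuple X Y Z Y' Z')))
  have hsmooth := smooth_part_minorant (S := S) hA2 hS.α_pos.le
    (mul_nonneg hε₀ (c₅_nonneg hS)) (mul_nonneg hε₀ (c₃_nonneg hS)) X w.fst.fst Y w.fst.snd.fst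
    Y' w.snd.fst Z w.fst.snd.snd Z' w.snd.snd hx hy hz
  have hinner := inner_quintuple
    (WithLp.toLp 2 fun i => s i + (S.A i).adjoint (Z + S.α • S.residual X Y) : Blocks n)
    (gradient S.h Y + S.B.adjoint (Z + S.α • S.residual X Y) + (2 * (ε₀ * S.c₃)) • (Y - Y'))
    (S.residual X Y + (2 * (ε₀ * S.c₅)) • S.B (S.B.adjoint (Z - Z')))
    (-((2 * (ε₀ * S.c₃)) • (Y - Y')))
    (-((2 * (ε₀ * S.c₅)) • S.B (S.B.adjoint (Z - Z')))) (w - quintuple X Y Z Y' Z')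
  change _ = ∑ i, inner ℝ (s i + (S.A i).adjoint (Z + S.α • S.residual X Y)) (w.fst.fst i - X i)
    + inner ℝ _ (w.fst.snd.fst - Y) + inner ℝ _ (w.fst.snd.snd - Z)
    + inner ℝ _ (w.snd.fst - Y') + inner ℝ _ (w.snd.snd - Z') at hinner
  simp only [inner_add_left (s _), Finset.sum_add_distrib] at hinner
  have hsum : ∑ i, S.f i (X i) + ((∑ i, (inner ℝ (s i) (w.fst.fst i - X i)
      - C i * ‖w.fst.fst i - X i‖ ^ 2) : ℝ) : EReal) ≤ ∑ i, S.f i (w.fst.fst i) := by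
    rw [EReal.coe_sum_real, ← Finset.sum_add_distrib]
    exact Finset.sum_le_sum fun i _ => hs i _
  have hCr : ∑ i, C i * ‖w.fst.fst i - X i‖ ^ 2 ≤ (∑ i, C i) * r ^ 2 := by
    rw [Finset.sum_mul]
    exact Finset.sum_le_sum fun i _ =>
      mul_le_mul_of_nonneg_left (pow_le_pow_left₀ (norm_nonneg _) (hx i) 2) (hC i)
  have hreal := add_le_add hsum (EReal.coe_le_coe_iff.2 hsmooth)
  have hvalw : S.modLagrangian ε₀ w = ∑ i, S.f i (w.fst.fst i)
      + (((S.h w.fst.snd.fst + S.coupling w.fst.fst w.fst.snd.fst w.fst.snd.snd)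
        + (ε₀ * S.c₅ * ‖S.B.adjoint (w.fst.snd.snd - w.snd.snd)‖ ^ 2
          + ε₀ * S.c₃ * ‖w.fst.snd.fst - w.snd.fst‖ ^ 2) : ℝ) : EReal) := by
    rw [EReal.coe_add, ← add_assoc]
    rfl
  rw [hvalw]
  refine le_trans ?_ hreal
  rw [hval, add_assoc (G := EReal), add_assoc (G := EReal), ← EReal.coe_add, ← EReal.coe_add]
  refine add_le_add_right (EReal.coe_le_coe_iff.2 ?_) _
  rw [modSubgradient, hinner, Finset.sum_sub_distrib]
  linarith

variable {x : ℕ → Blocks n} {y : ℕ → Vec q} {z : ℕ → Vec m}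

theorem norm_sub_block_le_stepLength (k : ℕ) (i : Fin p) :
    ‖x (k + 1) i - x k i‖ ≤ stepLength x y z k := by
  have h := Finset.single_le_sum (f := fun i => ‖x (k + 1) i - x k i‖)
    (fun i _ => norm_nonneg _) (Finset.mem_univ i)
  rw [stepLength]
  linarith [norm_nonneg (y (k + 1) - y k), norm_nonneg (z (k + 1) - z k)]

theorem norm_sub_y_le_stepLength (k : ℕ) : ‖y (k + 1) - y k‖ ≤ stepLength x y z k := by
  have h : 0 ≤ ∑ i, ‖x (k + 1) i - x k i‖ := Finset.sum_nonneg fun i _ => norm_nonneg _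
  rw [stepLength]
  linarith [norm_nonneg (z (k + 1) - z k)]

theorem norm_sub_z_le_stepLength (k : ℕ) : ‖z (k + 1) - z k‖ ≤ stepLength x y z k := by
  have h : 0 ≤ ∑ i, ‖x (k + 1) i - x k i‖ := Finset.sum_nonneg fun i _ => norm_nonneg _
  rw [stepLength]
  linarith [norm_nonneg (y (k + 1) - y k)]

theorem residual_eq_smul (hS : S.Setting) (hseq : S.IsSequence x y z) (k : ℕ) :
    S.residual (x (k + 1)) (y (k + 1)) = (S.α * S.β)⁻¹ • (z (k + 1) - z k) := by
  rw [hseq.z_step k, add_sub_cancel_left, smul_smul,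
    inv_mul_cancel₀ (mul_pos hS.α_pos hS.β_pos).ne', one_smul]

theorem norm_residual_sub_sweep_le (k : ℕ) (i : ℕ) :
    ‖S.residual (x (k + 1)) (y (k + 1)) - S.residual (sweep (x (k + 1)) (x k) i) (y k)‖ ≤
      S.constraintNorm * stepLength x y z k := by
  rw [residual_sub]
  refine S.norm_Amul_add_le (fun j => ?_) (norm_sub_y_le_stepLength k)
  by_cases hj : j.val < i
  · simp [sweep, hj, stepLength_nonneg]
  · simpa [sweep, hj] using norm_sub_block_le_stepLength (y := y) (z := z) k j

theorem exists_subgradient_bound (hS : S.Setting) {L : NNReal} (hA2 : S.A2 L) {ε₀ : ℝ}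
    (hε₀ : 0 ≤ ε₀) (hseq : S.IsSequence x y z) :
    ∃ C : ℝ, 0 ≤ C ∧ ∀ k, ∃ g ∈ limitingSubdiff (S.modLagrangian ε₀)
      (quintuple (x (k + 1)) (y (k + 1)) (z (k + 1)) (y k) (z k)),
      ‖g‖ ≤ C * stepLength x y z k := by
  have hα := hS.α_pos
  have hβ := hS.β_pos
  have hb : 0 ≤ 2 * (ε₀ * S.c₃) := by have := c₃_nonneg hS; positivity
  have ha : 0 ≤ 2 * (ε₀ * S.c₅) := by have := c₅_nonneg hS; positivity
  have hM := S.constraintNorm_nonneg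
  refine ⟨∑ i, (‖S.A i‖ * (1 + S.α * S.constraintNorm) + ‖S.Q i‖)
    + (‖S.B‖ + ‖S.P‖ + 2 * (ε₀ * S.c₃)) + ((S.α * S.β)⁻¹ + 2 * (ε₀ * S.c₅) * (‖S.B‖ * ‖S.B‖))
    + 2 * (ε₀ * S.c₃) + 2 * (ε₀ * S.c₅) * (‖S.B‖ * ‖S.B‖), by positivity, fun k => ?_⟩
  have hadj : ∀ {d d' : ℕ} (T : Vec d →L[ℝ] Vec d') (w : Vec d'),
      ‖T.adjoint w‖ ≤ ‖T‖ * ‖w‖ := fun T w => by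
    simpa using T.adjoint.le_opNorm w
  set δ := stepLength x y z k with hδ
  have hδ0 : 0 ≤ δ := stepLength_nonneg k
  have hx : ∀ i, ‖x (k + 1) i - x k i‖ ≤ δ := norm_sub_block_le_stepLength k
  have hy : ‖y (k + 1) - y k‖ ≤ δ := norm_sub_y_le_stepLength k
  have hz : ‖z (k + 1) - z k‖ ≤ δ := norm_sub_z_le_stepLength k
  have hBz : ‖S.B.adjoint (z (k + 1) - z k)‖ ≤ ‖S.B‖ * δ :=
    (hadj _ _).trans (by gcongr)
  have hBBz : ‖(2 * (ε₀ * S.c₅)) • S.B (S.B.adjoint (z (k + 1) - z k))‖ ≤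
      2 * (ε₀ * S.c₅) * (‖S.B‖ * ‖S.B‖) * δ := by
    rw [norm_smul, Real.norm_eq_abs, abs_of_nonneg ha, mul_assoc (2 * (ε₀ * S.c₅)),
      mul_assoc ‖S.B‖]
    gcongr
    exact (S.B.le_opNorm _).trans (by gcongr)
  have hcy : ‖(2 * (ε₀ * S.c₃)) • (y (k + 1) - y k)‖ ≤ 2 * (ε₀ * S.c₃) * δ := by
    rw [norm_smul, Real.norm_eq_abs, abs_of_nonneg hb]
    gcongr
  refine ⟨S.modSubgradient ε₀ (fun i => S.blockSubgradient (x (k + 1)) (x k) (y k) (z k) i)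
    (x (k + 1)) (y (k + 1)) (z (k + 1)) (y k) (z k),
    frechetSubdiff_subset_limitingSubdiff _ _ (modSubgradient_mem hS hA2 hε₀ (f_ne_top hS hseq k)
      (fun i => S.α / 2 * ‖S.A i‖ ^ 2 + ‖S.Q i‖ / 2) (fun i => by positivity)
      (fun i v => add_inner_blockSubgradient_le hS (hseq.x_step k i) v)), ?_⟩
  refine (norm_quintuple_le _ _ _ _ _).trans ?_
  have hgx : ∀ i, ‖S.blockSubgradient (x (k + 1)) (x k) (y k) (z k) i
      + (S.A i).adjoint (z (k + 1) + S.α • S.residual (x (k + 1)) (y (k + 1)))‖ ≤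
      (‖S.A i‖ * (1 + S.α * S.constraintNorm) + ‖S.Q i‖) * δ := by
    intro i
    -- The block subgradient carries the multiplier and residual seen within the sweep; adding the
    -- current ones leaves only differences of iterates.
    have h1 : S.blockSubgradient (x (k + 1)) (x k) (y k) (z k) i
      + (S.A i).adjoint (z (k + 1) + S.α • S.residual (x (k + 1)) (y (k + 1))) =
      (S.A i).adjoint ((z (k + 1) - z k) + S.α • (S.residual (x (k + 1)) (y (k + 1))
        - S.residual (sweep (x (k + 1)) (x k) (i + 1)) (y k)))
        - S.Q i (x (k + 1) i - x k i) := by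
      rw [blockSubgradient]
      simp only [map_add, map_sub, map_smul, smul_sub]
      abel
    rw [h1]
    have h2 : ‖(z (k + 1) - z k) + S.α • (S.residual (x (k + 1)) (y (k + 1))
        - S.residual (sweep (x (k + 1)) (x k) (i + 1)) (y k))‖ ≤
        (1 + S.α * S.constraintNorm) * δ := by
      refine (norm_add_le _ _).trans ?_
      rw [norm_smul, Real.norm_eq_abs, abs_of_pos hα, add_mul, one_mul, mul_assoc]
      gcongr
      exact norm_residual_sub_sweep_le k _
    refine (norm_sub_le _ _).trans ?_
    rw [add_mul, mul_assoc]
    gcongr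
    · exact (hadj _ _).trans (by gcongr)
    · exact ((S.Q i).le_opNorm _).trans (by gcongr; exact hx i)
  have hgy : ‖gradient S.h (y (k + 1)) + S.B.adjoint (z (k + 1)
      + S.α • S.residual (x (k + 1)) (y (k + 1))) + (2 * (ε₀ * S.c₃)) • (y (k + 1) - y k)‖ ≤
      (‖S.B‖ + ‖S.P‖ + 2 * (ε₀ * S.c₃)) * δ := by
    have h1 : gradient S.h (y (k + 1)) + S.B.adjoint (z (k + 1)
        + S.α • S.residual (x (k + 1)) (y (k + 1))) =
        S.B.adjoint (z (k + 1) - z k) - S.P (y (k + 1) - y k) := by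
      have h2 := y_optimality hS hA2 (hseq.y_step k)
      rw [map_add] at h2
      rw [← sub_eq_zero, ← h2, map_add, map_sub]
      abel
    rw [h1, add_mul, add_mul]
    refine (norm_add_le _ _).trans (add_le_add ((norm_sub_le _ _).trans (add_le_add hBz ?_)) hcy)
    exact (S.P.le_opNorm _).trans (by gcongr)
  have hgz : ‖S.residual (x (k + 1)) (y (k + 1))
      + (2 * (ε₀ * S.c₅)) • S.B (S.B.adjoint (z (k + 1) - z k))‖ ≤
      ((S.α * S.β)⁻¹ + 2 * (ε₀ * S.c₅) * (‖S.B‖ * ‖S.B‖)) * δ := by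
    rw [residual_eq_smul hS hseq, add_mul]
    refine (norm_add_le _ _).trans (add_le_add ?_ hBBz)
    rw [norm_smul, Real.norm_eq_abs, abs_of_pos (inv_pos.2 (mul_pos hα hβ))]
    gcongr
  rw [norm_neg, norm_neg, add_mul, add_mul, add_mul, add_mul, Finset.sum_mul]
  gcongr with i
  exact hgx i

end PADMM
-- Lower semicontinuity bounds the values from below, and the hypothesis with vanishing `r` bounds
-- them from above.
theorem LowerSemicontinuousAt.tendsto_of_add_le {X ι : Type*} [TopologicalSpace X] {l : Filter ι}
    {f : X → EReal} {x : X} (hf : LowerSemicontinuousAt f x) (hbot : f x ≠ ⊥) (htop : f x ≠ ⊤)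
    {u : ι → X} (hu : Tendsto u l (𝓝 x)) {r : ι → ℝ} (hr : Tendsto r l (𝓝 0))
    (h : ∀ j, f (u j) + (r j : EReal) ≤ f x) : Tendsto (fun j => f (u j)) l (𝓝 (f x)) := by
  refine tendsto_order.2 ⟨fun a ha => hu.eventually (hf a ha), fun b hb => ?_⟩
  have h1 : Tendsto (fun j => (((f x).toReal - r j : ℝ) : EReal)) l (𝓝 (f x)) := by
    have h2 : Tendsto (fun j => (f x).toReal - r j) l (𝓝 (f x).toReal) := by
      simpa using hr.const_sub (f x).toReal
    have h3 := (continuous_coe_real_ereal.tendsto (f x).toReal).comp h2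
    rwa [EReal.coe_toReal htop hbot] at h3
  filter_upwards [h1.eventually_lt_const hb] with j hj
  refine lt_of_le_of_lt ?_ hj
  have h4 := add_le_add_left (h j) ((-r j : ℝ) : EReal)
  rwa [add_assoc, ← EReal.coe_add, add_neg_cancel, EReal.coe_zero, add_zero,
    ← EReal.coe_toReal htop hbot, ← EReal.coe_add, ← sub_eq_add_neg] at h4

/-! ### Limit points, finite length and stationarity -/

namespace PADMM

variable {p : ℕ} {n : Fin p → ℕ} {q m : ℕ} {S : PADMM n q m}
variable {x : ℕ → Blocks n} {y : ℕ → Vec q} {z : ℕ → Vec m}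

theorem exists_bound_of_isBounded
    (hbdd : Bornology.IsBounded (Set.range fun k => triple (x k) (y k) (z k))) :
    ∃ R : ℝ, 0 ≤ R ∧ ∀ k, (∀ i, ‖x k i‖ ≤ R) ∧ ‖y k‖ ≤ R ∧ ‖z k‖ ≤ R := by
  obtain ⟨R, hR⟩ := isBounded_iff_forall_norm_le.1 hbdd
  have h : ∀ k, ‖triple (x k) (y k) (z k)‖ ≤ R := fun k => hR _ ⟨k, rfl⟩
  refine ⟨R, (norm_nonneg _).trans (h 0), fun k => ⟨fun i => ?_, ?_, ?_⟩⟩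
  · exact (PiLp.norm_apply_le (x k) i).trans
      ((WithLp.norm_fst_le_two (triple (x k) (y k) (z k))).trans (h k))
  · exact (WithLp.norm_fst_le_two (triple (x k) (y k) (z k)).snd).trans
      ((WithLp.norm_snd_le_two (triple (x k) (y k) (z k))).trans (h k))
  · exact (WithLp.norm_snd_le_two (triple (x k) (y k) (z k)).snd).trans
      ((WithLp.norm_snd_le_two (triple (x k) (y k) (z k))).trans (h k))

theorem exists_blockSubgradient_bound (hS : S.Setting)
    (hbdd : Bornology.IsBounded (Set.range fun k => triple (x k) (y k) (z k))) (i : Fin p) :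
    ∃ K : ℝ, ∀ k, ‖S.blockSubgradient (x (k + 1)) (x k) (y k) (z k) i‖ ≤ K := by
  obtain ⟨R, hR0, hR⟩ := exists_bound_of_isBounded hbdd
  have hα := hS.α_pos
  refine ⟨‖S.A i‖ * (R + S.α * (S.constraintNorm * R + ‖S.b‖)) + ‖S.Q i‖ * (R + R), fun k => ?_⟩
  have hres : ‖S.residual (sweep (x (k + 1)) (x k) (i + 1)) (y k)‖ ≤
      S.constraintNorm * R + ‖S.b‖ := by
    refine (norm_add_le _ _).trans (add_le_add_left (S.norm_Amul_add_le (fun j => ?_)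
      (hR k).2.1) _)
    change ‖if j.val < i.val + 1 then x (k + 1) j else x k j‖ ≤ R
    split_ifs
    exacts [(hR (k + 1)).1 j, (hR k).1 j]
  rw [blockSubgradient]
  refine (norm_sub_le _ _).trans (add_le_add ?_ ?_)
  · rw [norm_neg]
    refine ((ContinuousLinearMap.adjoint (S.A i)).le_opNorm _).trans ?_
    rw [LinearIsometryEquiv.norm_map]
    gcongr
    refine (norm_add_le _ _).trans (add_le_add (hR k).2.2 ?_)
    rw [norm_smul, Real.norm_eq_abs, abs_of_pos hα]
    gcongr
  · refine ((S.Q i).le_opNorm _).trans ?_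
    gcongr
    exact (norm_sub_le _ _).trans (add_le_add ((hR (k + 1)).1 i) ((hR k).1 i))

/-- The minorants at the iterates have slopes bounded by `K`. Evaluated at a point where `f i` is
finite, they keep the values bounded, so `f i v` is finite; evaluated at `v` itself, they bound the
upper limit by `f i v`. -/
theorem tendsto_f_of_tendsto (hS : S.Setting) (hA1 : S.A1) (hseq : S.IsSequence x y z)
    (hbdd : Bornology.IsBounded (Set.range fun k => triple (x k) (y k) (z k)))
    {φ : ℕ → ℕ} {i : Fin p} {v : Vec (n i)}
    (hv : Tendsto (fun j => x (φ j + 1) i) atTop (𝓝 v)) :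
    S.f i v ≠ ⊤ ∧ Tendsto (fun j => S.f i (x (φ j + 1) i)) atTop (𝓝 (S.f i v)) := by
  obtain ⟨K, hK⟩ := exists_blockSubgradient_bound hS hbdd i
  have hK0 : 0 ≤ K := (norm_nonneg _).trans (hK 0)
  have hα := hS.α_pos
  set C := S.α / 2 * ‖S.A i‖ ^ 2 + ‖S.Q i‖ / 2 with hC
  have hC0 : 0 ≤ C := by positivity
  set s : ℕ → Vec (n i) := fun j =>
    S.blockSubgradient (x (φ j + 1)) (x (φ j)) (y (φ j)) (z (φ j)) i with hs
  have hmin : ∀ w j, S.f i (x (φ j + 1) i) + ((inner ℝ (s j) (w - x (φ j + 1) i)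
      - C * ‖w - x (φ j + 1) i‖ ^ 2 : ℝ) : EReal) ≤ S.f i w := fun w j =>
    add_inner_blockSubgradient_le hS (hseq.x_step (φ j) i) w
  have hlow : ∀ w j, -(K * ‖w - x (φ j + 1) i‖ + C * ‖w - x (φ j + 1) i‖ ^ 2) ≤
      inner ℝ (s j) (w - x (φ j + 1) i) - C * ‖w - x (φ j + 1) i‖ ^ 2 := by
    intro w j
    have h1 := neg_le_of_abs_le (abs_real_inner_le_norm (s j) (w - x (φ j + 1) i))
    have h2 := mul_le_mul_of_nonneg_right (hK (φ j)) (norm_nonneg (w - x (φ j + 1) i))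
    linarith
  have hlsc : LowerSemicontinuousAt (S.f i) v := (hA1 i).1 v
  have hdist : ∀ w, Tendsto (fun j => K * ‖w - x (φ j + 1) i‖ + C * ‖w - x (φ j + 1) i‖ ^ 2) atTop
      (𝓝 (K * ‖w - v‖ + C * ‖w - v‖ ^ 2)) := fun w =>
    ((hv.const_sub w).norm.const_mul K).add (((hv.const_sub w).norm.pow 2).const_mul C)
  have htop : S.f i v ≠ ⊤ := by
    intro htop
    obtain ⟨w, hw⟩ := hS.f_proper i
    set M := K * ‖w - v‖ + C * ‖w - v‖ ^ 2 + 1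
    have h1 : ∀ᶠ j in atTop, K * ‖w - x (φ j + 1) i‖ + C * ‖w - x (φ j + 1) i‖ ^ 2 < M :=
      (hdist w).eventually_lt_const (lt_add_one _)
    have h2 : ∀ᶠ j in atTop, (((S.f i w).toReal + M : ℝ) : EReal) < S.f i (x (φ j + 1) i) :=
      hv.eventually (hlsc _ (by change _ < S.f i v; rw [htop]; exact EReal.coe_lt_top _))
    obtain ⟨j, hj1, hj2⟩ := (h1.and h2).exists
    have h3 := toReal_add_le_toReal (hS.f_ne_bot _ _) (f_ne_top hS hseq (φ j) i)
      (hS.f_ne_bot _ _) hw (hmin w j)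
    rw [← EReal.coe_toReal (f_ne_top hS hseq (φ j) i) (hS.f_ne_bot _ _),
      EReal.coe_lt_coe_iff] at hj2
    linarith [hlow w j]
  refine ⟨htop, hlsc.tendsto_of_add_le (hS.f_ne_bot _ _) htop hv
    (r := fun j => -(K * ‖v - x (φ j + 1) i‖ + C * ‖v - x (φ j + 1) i‖ ^ 2)) ?_ fun j => ?_⟩
  · simpa using (hdist v).neg
  · exact le_trans (add_le_add_right (EReal.coe_le_coe_iff.2 (hlow v j)) _) (hmin v j)

theorem tendsto_residual {u : ℕ → Blocks n} {v : ℕ → Vec q} {X : Blocks n} {Y : Vec q}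
    (hu : Tendsto u atTop (𝓝 X)) (hv : Tendsto v atTop (𝓝 Y)) :
    Tendsto (fun j => S.residual (u j) (v j)) atTop (𝓝 (S.residual X Y)) := by
  have hui : ∀ i, Tendsto (fun j => u j i) atTop (𝓝 (X i)) := fun i =>
    ((PiLp.continuous_apply 2 _ i).tendsto X).comp hu
  exact ((tendsto_finsetSum _ fun i _ => ((S.A i).continuous.tendsto (X i)).comp (hui i)).add
    ((S.B.continuous.tendsto Y).comp hv)).add_const S.b

theorem lyapunov_tendsto_of_mem_limitSet (hS : S.Setting) {L : NNReal} (hA1 : S.A1) (hA2 : S.A2 L)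
    (hseq : S.IsSequence x y z)
    (hbdd : Bornology.IsBounded (Set.range fun k => triple (x k) (y k) (z k))) (ε₀ : ℝ)
    (hanti : Antitone (S.lyapunov ε₀ x y z)) {w : Quintuple n q m} (hw : w ∈ limitSet x y z) :
    ∃ l : ℝ, S.modLagrangian ε₀ w = (l : EReal) ∧
      Tendsto (S.lyapunov ε₀ x y z) atTop (𝓝 l) := by
  obtain ⟨φ, hφ, hlim⟩ := hw
  have h1 := ((WithLp.fstL 2 ℝ _ _).continuous.tendsto w).comp hlim
  have h2 := ((WithLp.sndL 2 ℝ _ _).continuous.tendsto w).comp hlim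
  have hx : Tendsto (fun j => x (φ j + 1)) atTop (𝓝 w.fst.fst) :=
    ((WithLp.fstL 2 ℝ _ _).continuous.tendsto w.fst).comp h1
  have h3 := ((WithLp.sndL 2 ℝ _ _).continuous.tendsto w.fst).comp h1
  have hy : Tendsto (fun j => y (φ j + 1)) atTop (𝓝 w.fst.snd.fst) :=
    ((WithLp.fstL 2 ℝ _ _).continuous.tendsto w.fst.snd).comp h3
  have hz : Tendsto (fun j => z (φ j + 1)) atTop (𝓝 w.fst.snd.snd) :=
    ((WithLp.sndL 2 ℝ _ _).continuous.tendsto w.fst.snd).comp h3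
  have hy' : Tendsto (fun j => y (φ j)) atTop (𝓝 w.snd.fst) :=
    ((WithLp.fstL 2 ℝ _ _).continuous.tendsto w.snd).comp h2
  have hz' : Tendsto (fun j => z (φ j)) atTop (𝓝 w.snd.snd) :=
    ((WithLp.sndL 2 ℝ _ _).continuous.tendsto w.snd).comp h2
  have hf : ∀ i, S.f i (w.fst.fst i) ≠ ⊤ ∧
      Tendsto (fun j => S.f i (x (φ j + 1) i)) atTop (𝓝 (S.f i (w.fst.fst i))) := fun i =>
    tendsto_f_of_tendsto hS hA1 hseq hbdd
      (((PiLp.continuous_apply 2 _ i).tendsto w.fst.fst).comp hx)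
  set l : ℝ := ∑ i, (S.f i (w.fst.fst i)).toReal
    + (S.h w.fst.snd.fst + S.coupling w.fst.fst w.fst.snd.fst w.fst.snd.snd)
    + (ε₀ * S.c₅ * ‖S.B.adjoint (w.fst.snd.snd - w.snd.snd)‖ ^ 2
      + ε₀ * S.c₃ * ‖w.fst.snd.fst - w.snd.fst‖ ^ 2) with hl
  refine ⟨l, ?_, ?_⟩
  · rw [hl, EReal.coe_add, EReal.coe_add, EReal.coe_sum_real]
    simp only [EReal.coe_toReal (hf _).1 (hS.f_ne_bot _ _)]
    rfl
  -- Monotonicity lifts convergence along one subsequence to the whole sequence, so no separate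
  -- lower bound is required.
  · rw [tendsto_iff_tendsto_subseq_of_antitone hanti hφ.tendsto_atTop]
    have hr : Tendsto (fun j => S.residual (x (φ j + 1)) (y (φ j + 1))) atTop
        (𝓝 (S.residual w.fst.fst w.fst.snd.fst)) :=
      tendsto_residual hx hy
    have t1 : Tendsto (fun j => ∑ i, (S.f i (x (φ j + 1) i)).toReal) atTop
        (𝓝 (∑ i, (S.f i (w.fst.fst i)).toReal)) :=
      tendsto_finsetSum _ fun i _ =>
        (EReal.tendsto_toReal (hf i).1 (hS.f_ne_bot _ _)).comp (hf i).2
    have t2 : Tendsto (fun j => S.h (y (φ j + 1))) atTop (𝓝 (S.h w.fst.snd.fst)) :=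
      (hA2.2.1.continuous.tendsto _).comp hy
    have t3 : Tendsto (fun j => S.coupling (x (φ j + 1)) (y (φ j + 1)) (z (φ j + 1))) atTop
        (𝓝 (S.coupling w.fst.fst w.fst.snd.fst w.fst.snd.snd)) :=
      (hz.inner hr).add ((hr.norm.pow 2).const_mul _)
    have t4 : Tendsto (fun j => ‖S.B.adjoint (z (φ j + 1) - z (φ j))‖ ^ 2) atTop
        (𝓝 (‖S.B.adjoint (w.fst.snd.snd - w.snd.snd)‖ ^ 2)) :=
      ((S.B.adjoint.continuous.tendsto _).comp (hz.sub hz')).norm.pow 2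
    have t5 : Tendsto (fun j => ‖y (φ j + 1) - y (φ j)‖ ^ 2) atTop
        (𝓝 (‖w.fst.snd.fst - w.snd.fst‖ ^ 2)) := (hy.sub hy').norm.pow 2
    exact (t1.add (t2.add t3)).add ((t4.const_mul _).add (t5.const_mul _))

theorem isBounded_range_quintuple
    (hbdd : Bornology.IsBounded (Set.range fun k => triple (x k) (y k) (z k))) :
    Bornology.IsBounded
      (Set.range fun k => quintuple (x (k + 1)) (y (k + 1)) (z (k + 1)) (y k) (z k)) := by
  obtain ⟨R, -, hR⟩ := exists_bound_of_isBounded hbdd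
  refine isBounded_iff_forall_norm_le.2 ⟨∑ _i : Fin p, R + R + R + R + R, ?_⟩
  rintro _ ⟨k, rfl⟩
  refine (norm_quintuple_le _ _ _ _ _).trans ?_
  gcongr with i
  exacts [(hR (k + 1)).1 i, (hR (k + 1)).2.1, (hR (k + 1)).2.2, (hR k).2.1, (hR k).2.2]

theorem summable_stepLength (hp : 1 ≤ p) (hS : S.Setting) {L : NNReal} {ε₀ : ℝ}
    {qc εc : Fin p → ℝ} (hA1 : S.A1) (hA2 : S.A2 L) (hA3 : S.A3) (hA4 : S.A4 qc εc)
    (hε₀ : 1 < ε₀) (hσ : 0 < S.sigma L ε₀ qc εc) (hseq : S.IsSequence x y z)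
    (hbdd : Bornology.IsBounded (Set.range fun k => triple (x k) (y k) (z k)))
    (hKL : HasKLOn (S.modLagrangian ε₀) (limitSet x y z)) : Summable (stepLength x y z) := by
  obtain ⟨a, ha, hdec⟩ := exists_lyapunov_decrease hp hS hA2 hA3 hA4 hε₀ hσ hseq
  obtain ⟨C, hC, hsub⟩ := exists_subgradient_bound hS hA2 (zero_lt_one.trans hε₀).le hseq
  have hanti : Antitone (S.lyapunov ε₀ x y z) := antitone_nat_of_succ_le fun k => by
    have : 0 ≤ a * stepLength x y z (k + 1) ^ 2 := by positivity
    linarith [hdec k]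
  have hqbdd := isBounded_range_quintuple hbdd
  obtain ⟨w, -, θ, hθ, hw⟩ := tendsto_subseq_of_bounded hqbdd fun k => Set.mem_range_self k
  have hwΩ : w ∈ limitSet x y z := ⟨θ, hθ, hw⟩
  obtain ⟨l, hl, hlim⟩ := lyapunov_tendsto_of_mem_limitSet hS hA1 hA2 hseq hbdd ε₀ hanti hwΩ
  -- One limit point is enough: the inequality attached to `w` is valid near the whole limit set, so
  -- no covering argument is needed.
  obtain ⟨ε, hε, η, hη, ψ, hψ, hineq⟩ := hKL w hwΩ
  refine summable_of_desingularizing hη hψ (φ := fun k => S.lyapunov ε₀ x y z k - l) ha hC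
    (fun k => sub_nonneg.2 (hanti.le_of_tendsto hlim k)) (by simpa using hlim.sub_const l)
    stepLength_nonneg (fun k => by linarith [hdec k]) ?_
  filter_upwards [tendsto_infEDist_subseqLimits hqbdd (ENNReal.ofReal_pos.2 hε)] with k hk hpos hlt
  have h1 := hineq _ hk
  rw [modLagrangian_eq_lyapunov hS hseq, hl, ← EReal.coe_add, EReal.coe_lt_coe_iff,
    EReal.coe_lt_coe_iff, ← EReal.coe_sub, EReal.toReal_coe] at h1
  have h2 := h1 (by linarith) (by linarith)
  obtain ⟨g, hg, hgn⟩ := hsub k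
  have h3 : Metric.infEDist 0 (limitingSubdiff (S.modLagrangian ε₀)
      (quintuple (x (k + 1)) (y (k + 1)) (z (k + 1)) (y k) (z k))) ≤
      ENNReal.ofReal (C * stepLength x y z k) := by
    refine (Metric.infEDist_le_edist_of_mem hg).trans ?_
    rw [edist_dist, dist_zero_left]
    exact ENNReal.ofReal_le_ofReal hgn
  have h4 := h2.trans (mul_le_mul_right h3 _)
  rw [← ENNReal.ofReal_mul (hψ.deriv_pos _ ⟨hpos, hlt⟩).le] at h4
  exact ENNReal.one_le_ofReal.1 h4

/-- The block subgradients converge to `-A_iᵀ z'` while points and function values converge, which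
is exactly membership in the limiting subdifferential. Feasibility holds because the residual is a
multiple of `Δz`. -/
theorem isStationary_of_tendsto (hS : S.Setting) {L : NNReal} (hA1 : S.A1) (hA2 : S.A2 L)
    (hseq : S.IsSequence x y z)
    (hbdd : Bornology.IsBounded (Set.range fun k => triple (x k) (y k) (z k)))
    (hstep : Tendsto (stepLength x y z) atTop (𝓝 0)) {x' : Blocks n} {y' : Vec q} {z' : Vec m}
    (hx : Tendsto x atTop (𝓝 x')) (hy : Tendsto y atTop (𝓝 y')) (hz : Tendsto z atTop (𝓝 z')) :
    S.IsStationary x' y' z' := by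
  have hx1 := hx.comp (tendsto_add_atTop_nat 1)
  have hy1 := hy.comp (tendsto_add_atTop_nat 1)
  have hr0 : Tendsto (fun k => S.residual (x (k + 1)) (y (k + 1))) atTop (𝓝 0) := by
    simp only [residual_eq_smul hS hseq]
    have : Tendsto (fun k => z (k + 1) - z k) atTop (𝓝 0) := by
      simpa using (hz.comp (tendsto_add_atTop_nat 1)).sub hz
    simpa using this.const_smul (S.α * S.β)⁻¹
  have hfeas : S.residual x' y' = 0 :=
    tendsto_nhds_unique (tendsto_residual hx1 hy1) hr0
  refine ⟨fun i => ?_, ?_, hfeas⟩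
  · have hxi : Tendsto (fun k => x k i) atTop (𝓝 (x' i)) :=
      ((PiLp.continuous_apply 2 _ i).tendsto x').comp hx
    have hxi1 : Tendsto (fun k => x (k + 1) i) atTop (𝓝 (x' i)) :=
      hxi.comp (tendsto_add_atTop_nat 1)
    obtain ⟨htop, hf⟩ := tendsto_f_of_tendsto hS hA1 hseq hbdd (φ := fun k => k) hxi1
    refine ⟨-((S.A i).adjoint z'), ⟨htop, fun k => x (k + 1) i,
      fun k => S.blockSubgradient (x (k + 1)) (x k) (y k) (z k) i, hxi1, hf,
      fun k => blockSubgradient_mem hS (hseq.x_step k i), ?_⟩, neg_add_cancel _⟩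
    -- The residual within the sweep differs from the one after the `y`-update by at most a multiple
    -- of the step length, so it vanishes as well.
    have hsweep : Tendsto (fun k => S.residual (sweep (x (k + 1)) (x k) (i + 1)) (y k)) atTop
        (𝓝 0) := by
      have h1 : Tendsto (fun k => S.residual (x (k + 1)) (y (k + 1))
          - S.residual (sweep (x (k + 1)) (x k) (i + 1)) (y k)) atTop (𝓝 0) :=
        squeeze_zero_norm (fun k => norm_residual_sub_sweep_le (z := z) k _)
          (by simpa using hstep.const_mul S.constraintNorm)
      simpa using hr0.sub h1
    have h2 := ((S.A i).adjoint.continuous.tendsto _).comp (hz.add (hsweep.const_smul S.α))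
    have h3 := ((S.Q i).continuous.tendsto _).comp (hxi1.sub hxi)
    have h4 : -((S.A i).adjoint (z' + S.α • 0)) - S.Q i (x' i - x' i) =
        -((S.A i).adjoint z') := by simp
    rw [← h4]
    exact h2.neg.sub h3
  · have hg := (hA2.2.2.continuous.tendsto y').comp hy1
    have h2 := (S.B.adjoint.continuous.tendsto _).comp (hz.add (hr0.const_smul S.α))
    have h3 := (S.P.continuous.tendsto _).comp (hy1.sub hy)
    have h4 := (hg.add h2).add h3
    have h5 : (fun k => gradient S.h (y (k + 1)) + S.B.adjoint (z k
        + S.α • S.residual (x (k + 1)) (y (k + 1))) + S.P (y (k + 1) - y k)) = fun _ => 0 :=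
      funext fun k => y_optimality hS hA2 (hseq.y_step k)
    have h6 := tendsto_nhds_unique (tendsto_const_nhds.congr fun k => (congrFun h5 k).symm) h4
    simpa using h6.symm

end PADMM
theorem theorem1 {p : ℕ} (hp : 1 ≤ p) {n : Fin p → ℕ} {q m : ℕ} (S : PADMM n q m)
    (hS : S.Setting)
    (L : NNReal) (qc εc : Fin p → ℝ)
    (hA1 : S.A1) (hA2 : S.A2 L) (hA3 : S.A3) (hA4 : S.A4 qc εc)
    (ε₀ : ℝ) (hε₀ : 1 < ε₀) (hσ : 0 < S.sigma L ε₀ qc εc)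
    (x : ℕ → Blocks n) (y : ℕ → Vec q) (z : ℕ → Vec m)
    (hseq : S.IsSequence x y z)
    (hbdd : Bornology.IsBounded (Set.range fun k => triple (x k) (y k) (z k)))
    (hKL : HasKLOn (S.modLagrangian ε₀) (PADMM.limitSet x y z)) :
    Summable (fun k => (∑ i, ‖x (k + 1) i - x k i‖) + ‖y (k + 1) - y k‖ + ‖z (k + 1) - z k‖) ∧
    Summable (fun k => ‖triple (x (k + 1)) (y (k + 1)) (z (k + 1)) - triple (x k) (y k) (z k)‖) ∧
    ∑' k, ‖triple (x (k + 1)) (y (k + 1)) (z (k + 1)) - triple (x k) (y k) (z k)‖ ≤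
      ∑' k, ((∑ i, ‖x (k + 1) i - x k i‖) + ‖y (k + 1) - y k‖ + ‖z (k + 1) - z k‖) ∧
    CauchySeq (fun k => triple (x k) (y k) (z k)) ∧
    ∃ (x' : Blocks n) (y' : Vec q) (z' : Vec m),
      Tendsto (fun k => triple (x k) (y k) (z k)) atTop (𝓝 (triple x' y' z')) ∧
      S.IsStationary x' y' z' := by
  have hsum := PADMM.summable_stepLength hp hS hA1 hA2 hA3 hA4 hε₀ hσ hseq hbdd hKL
  have hle : ∀ k, ‖triple (x (k + 1)) (y (k + 1)) (z (k + 1)) - triple (x k) (y k) (z k)‖ ≤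
      PADMM.stepLength x y z k := fun k =>
    PADMM.norm_triple_le (x (k + 1) - x k) (y (k + 1) - y k) (z (k + 1) - z k)
  have hsum' := Summable.of_nonneg_of_le (fun k => norm_nonneg _) hle hsum
  have hcauchy : CauchySeq (fun k => triple (x k) (y k) (z k)) :=
    cauchySeq_of_summable_dist (hsum'.congr fun k => by rw [dist_comm, dist_eq_norm])
  refine ⟨hsum, hsum', hsum'.tsum_le_tsum hle hsum, hcauchy, ?_⟩
  obtain ⟨u, hu⟩ := cauchySeq_tendsto_of_complete hcauchy
  have h1 := ((WithLp.sndL 2 ℝ _ _).continuous.tendsto u).comp hu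
  exact ⟨u.fst, u.snd.fst, u.snd.snd, hu,
    PADMM.isStationary_of_tendsto hS hA1 hA2 hseq hbdd hsum.tendsto_atTop_zero
      (((WithLp.fstL 2 ℝ _ _).continuous.tendsto u).comp hu)
      (((WithLp.fstL 2 ℝ _ _).continuous.tendsto u.snd).comp h1)
      (((WithLp.sndL 2 ℝ _ _).continuous.tendsto u.snd).comp h1)⟩
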